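/- Let $m\ge 1$. For an integer $n\ge 1$ let $\mathscr L_n$ be the operator on functions $f:\mathbb Z/n\mathbb Z\to\mathbb R$ given by $$(\mathscr L_n f)(k)=\frac{n^2}{4\pi^2}\bigl((f(k)-f(k-1))+(f(k)-f(k+1))\bigr),$$ and let $\Delta_n$ be the combinatorial Laplacian on functions on the discrete torus $(\mathbb Z/n\mathbb Z)^m$, i.e. the sum over the $m$ coordinates of $\mathscr L_n$ acting in that coordinate. Write $\mathbb R_+=(0,\infty)$. Say that $f:\mathbb R_+\to\mathbb C$ has a log-polyhomogeneous expansion at infinity if for every $r\ge 0$ there are $N\ge 1$, exponents $\alpha_1,\dots,\alpha_N\in\mathbb C$ with $\operatorname{Re}\alpha_1\ge\dots\ge\operatorname{Re}\alpha_N$ and $\operatorname{Re}\alpha_N<-r$, integers $M_0,\dots,M_N\ge 0$ and coefficients $a_{jk}\in\mathbb C$ such that, as $x\to\infty$, $$f(x)=\sum_{j=1}^{N-1}\sum_{k=0}^{M_j}a_{jk}\,x^{\alpha_j}\log^k x+\sum_{k=0}^{M_0}a_{0k}\log^k x+o\bigl(x^{\alpha_N}\log^{M_N}x\bigr).$$ **Theorem.**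 There are functions $h_{-m},h_{-m-1},\dots,h_{-2m}:\mathbb R_+^2\to\mathbb R$ and $H:\mathbb R_+\times\mathbb Z_{\ge 1}\to\mathbb R$ such that for all $z>0$ and all integers $n\ge1$ $$\operatorname{Tr}(\Delta_n+z^2)^{-m}=\sum_{j=0}^{m}h_{-m-j}(z,n)+H(z,n),$$ and such that the following hold. 1. For each $j=0,\dots,m$, $h_{-m-j}\in C^\infty(\mathbb R_+^2)$, and it is jointly homogeneous of order $-m-j$: $h_{-m-j}(tz,tn)=t^{-m-j}h_{-m-j}(z,n)$ for all real $t,z,n>0$. 2. For each $j=0,\dots,m$, both functions $z\mapsto h_{-m-j}(z,1)$ and $n\mapsto h_{-m-j}(1,n)$ on $\mathbb R_+$ have a log-polyhomogeneous expansion at infinity. 3. $H(z,n)=O(z^{-2m-2})$ as $z\to\infty$, uniformly in $n$: there are constants $C$ and $z_0>0$, depending only on $m$, with $|H(z,n)|\le C z^{-2m-2}$ for all $z\ge z_0$ and all integers $n\ge 1$. 4. $h_{-2m}(z,n)=0$ for all $z,n>0$. -/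

import Mathlib

open Filter Asymptotics
open scoped ContDiff

/-- The discrete Laplacian on the discrete circle `ℤ/nℤ`. -/
noncomputable def circleLaplacian (n : ℕ) : (ZMod n → ℝ) →ₗ[ℝ] (ZMod n → ℝ) where
  toFun f k := (n : ℝ) ^ 2 / (4 * Real.pi ^ 2) * ((f k - f (k - 1)) + (f k - f (k + 1)))
  map_add' f g := by
    funext k
    simp only [Pi.add_apply]
    ring
  map_smul' c f := by
    funext k
    simp only [Pi.smul_apply, smul_eq_mul, RingHom.id_apply]
    ring

/-- The combinatorial Laplacian on the discrete torus `(ℤ/nℤ)^m`: the sum over `i` of the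
circle Laplacians acting in the `i`-th coordinate. -/
noncomputable def torusLaplacian (m n : ℕ) : Module.End ℝ ((Fin m → ZMod n) → ℝ) where
  toFun f x := ∑ i : Fin m, circleLaplacian n (fun t => f (Function.update x i t)) (x i)
  map_add' f g := by
    funext x
    simp only [Pi.add_apply, ← Finset.sum_add_distrib]
    refine Finset.sum_congr rfl fun i _ => ?_
    exact congrFun ((circleLaplacian n).map_add (fun t => f (Function.update x i t))
      (fun t => g (Function.update x i t))) (x i)
  map_smul' c f := by
    funext x
    simp only [Pi.smul_apply, RingHom.id_apply, Finset.smul_sum]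
    refine Finset.sum_congr rfl fun i _ => ?_
    exact congrFun ((circleLaplacian n).map_smul c (fun t => f (Function.update x i t))) (x i)

/-- The operator `Δ_n + z²`. -/
noncomputable def shiftedLaplacian (m n : ℕ) (z : ℝ) : Module.End ℝ ((Fin m → ZMod n) → ℝ) :=
  torusLaplacian m n + z ^ 2 • (1 : Module.End ℝ ((Fin m → ZMod n) → ℝ))

theorem torusLaplacian_nonneg_of_max (m n : ℕ) (f : (Fin m → ZMod n) → ℝ) (x : Fin m → ZMod n)
    (hx : ∀ y, f y ≤ f x) : 0 ≤ torusLaplacian m n f x := by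
  change 0 ≤ ∑ i : Fin m, (n : ℝ) ^ 2 / (4 * Real.pi ^ 2) *
    ((f (Function.update x i (x i)) - f (Function.update x i (x i - 1))) +
      (f (Function.update x i (x i)) - f (Function.update x i (x i + 1))))
  refine Finset.sum_nonneg fun i _ => mul_nonneg (by positivity) ?_
  rw [Function.update_eq_self]
  linarith [hx (Function.update x i (x i - 1)), hx (Function.update x i (x i + 1))]

theorem le_zero_of_shiftedLaplacian_eq_zero (m n : ℕ) (hn : 0 < n) (z : ℝ) (hz : 0 < z)
    (f : (Fin m → ZMod n) → ℝ) (hf : shiftedLaplacian m n z f = 0) (y : Fin m → ZMod n) :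
    f y ≤ 0 := by
  have : NeZero n := ⟨hn.ne'⟩
  obtain ⟨x, hx⟩ := Finite.exists_max f
  have h1 := torusLaplacian_nonneg_of_max m n f x hx
  have h2 : torusLaplacian m n f x + z ^ 2 * f x = 0 := congrFun hf x
  have h3 : 0 < z ^ 2 := by positivity
  have h4 : f x ≤ 0 := by
    by_contra hc
    have := mul_pos h3 (not_le.mp hc)
    linarith
  exact (hx y).trans h4

/-- For `n ≥ 1` and `z > 0` the operator `Δ_n + z²` is invertible, so that `Ring.inverse` below
is its genuine inverse. -/
theorem isUnit_shiftedLaplacian (m n : ℕ) (hn : 0 < n) (z : ℝ) (hz : 0 < z) :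
    IsUnit (shiftedLaplacian m n z) := by
  have : NeZero n := ⟨hn.ne'⟩
  rw [LinearMap.isUnit_iff_ker_eq_bot, LinearMap.ker_eq_bot']
  intro f hf
  funext y
  have h1 := le_zero_of_shiftedLaplacian_eq_zero m n hn z hz f hf y
  have h2 := le_zero_of_shiftedLaplacian_eq_zero m n hn z hz (-f) (by rw [map_neg, hf, neg_zero]) y
  have h3 : -f y ≤ 0 := h2
  have h4 : 0 ≤ f y := by linarith
  exact le_antisymm h1 h4

/-- The resolvent trace `Tr (Δ_n + z²)^{-m}` on the `m`-dimensional discrete torus. -/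
noncomputable def resolventTrace (m n : ℕ) (z : ℝ) : ℝ :=
  LinearMap.trace ℝ ((Fin m → ZMod n) → ℝ) (Ring.inverse (shiftedLaplacian m n z) ^ m)

/-- `f` admits a log-polyhomogeneous expansion as `x → ∞`, to arbitrarily high order: for every
`r ≥ 0` there are `N ≥ 1`, exponents `α 1, …, α N` with decreasing real parts and
`Re (α N) < -r`, and coefficients such that
`f x = ∑_{j=1}^{N-1} ∑_{k=0}^{M j} a j k * x ^ (α j) * log(x) ^ k + ∑_{k=0}^{M 0} a 0 k * log(x) ^ k
  + o (x ^ (α N) * log(x) ^ (M N))`. -/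
def HasLogPolyhomogeneousExpansion (f : ℝ → ℂ) : Prop :=
  ∀ r : ℝ, 0 ≤ r → ∃ (N : ℕ) (α : ℕ → ℂ) (M : ℕ → ℕ) (a : ℕ → ℕ → ℂ),
    1 ≤ N ∧
    (∀ i j : ℕ, 1 ≤ i → i ≤ j → j ≤ N → (α j).re ≤ (α i).re) ∧
    (α N).re < -r ∧
    (fun x : ℝ => f x -
        ((∑ j ∈ Finset.Ico 1 N, ∑ k ∈ Finset.range (M j + 1),
            a j k * (x : ℂ) ^ (α j) * (Real.log x : ℂ) ^ k) +
          ∑ k ∈ Finset.range (M 0 + 1), a 0 k * (Real.log x : ℂ) ^ k))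
      =o[atTop] fun x : ℝ => (x : ℂ) ^ (α N) * (Real.log x : ℂ) ^ (M N)

/-! ### Diagonalization of the torus Laplacian by the Hartley transform -/

/-- The Hartley kernel `cos + sin` on `ℤ/nℤ`. -/
noncomputable def hartley (n : ℕ) [NeZero n] (t : ZMod n) : ℝ :=
  (ZMod.stdAddChar t : ℂ).re + (ZMod.stdAddChar t : ℂ).im

/-- The cosine on `ℤ/nℤ`. -/
noncomputable def cosMod (n : ℕ) [NeZero n] (t : ZMod n) : ℝ := (ZMod.stdAddChar t : ℂ).re

theorem stdAddChar_neg_eq_conj (n : ℕ) [NeZero n] (t : ZMod n) :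
    (ZMod.stdAddChar (-t) : ℂ) = (starRingEnd ℂ) (ZMod.stdAddChar t) := by
  rw [AddChar.map_neg_eq_conj]

theorem hartley_add_add_hartley_sub (n : ℕ) [NeZero n] (a b : ZMod n) :
    hartley n (a + b) + hartley n (a - b) = 2 * cosMod n b * hartley n a := by
  simp only [hartley, cosMod, sub_eq_add_neg, AddChar.map_add_eq_mul, stdAddChar_neg_eq_conj,
    Complex.mul_re, Complex.mul_im, Complex.conj_re, Complex.conj_im]
  ring

theorem hartley_mul_hartley (n : ℕ) [NeZero n] (a b : ZMod n) :
    hartley n a * hartley n b =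
      (ZMod.stdAddChar (a - b) : ℂ).re + (ZMod.stdAddChar (a + b) : ℂ).im := by
  simp only [hartley, sub_eq_add_neg, AddChar.map_add_eq_mul, stdAddChar_neg_eq_conj,
    Complex.mul_re, Complex.mul_im, Complex.conj_re, Complex.conj_im]
  ring

theorem sum_hartley_mul_hartley (n : ℕ) [NeZero n] (x y : ZMod n) :
    ∑ k : ZMod n, hartley n (x * k) * hartley n (k * y) = if x = y then (n : ℝ) else 0 := by
  have key : ∀ b : ZMod n, ∑ k : ZMod n, (ZMod.stdAddChar (k * b) : ℂ) =
      if b = 0 then (n : ℂ) else 0 := by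
    intro b
    rw [AddChar.sum_mulShift b (ZMod.isPrimitive_stdAddChar n), ZMod.card]
    split_ifs <;> simp
  have h1 : ∀ k : ZMod n, hartley n (x * k) * hartley n (k * y) =
      (ZMod.stdAddChar (k * (x - y)) : ℂ).re + (ZMod.stdAddChar (k * (x + y)) : ℂ).im := by
    intro k
    rw [hartley_mul_hartley]
    congr 3 <;> ring_nf
  simp_rw [h1, Finset.sum_add_distrib, ← Complex.re_sum, ← Complex.im_sum, key, sub_eq_zero]
  split_ifs <;> simp

/-- The separable Hartley kernel on the discrete torus. -/
noncomputable def torusHartley (m n : ℕ) [NeZero n] :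
    Matrix (Fin m → ZMod n) (Fin m → ZMod n) ℝ :=
  Matrix.of fun x k => ∏ i, hartley n (x i * k i)

/-- The eigenvalues of `torusLaplacian m n`. -/
noncomputable def torusEigenvalue (m n : ℕ) [NeZero n] (k : Fin m → ZMod n) : ℝ :=
  ∑ i, (n : ℝ) ^ 2 / (2 * Real.pi ^ 2) * (1 - cosMod n (k i))

theorem torusHartley_mul_self (m n : ℕ) [NeZero n] :
    torusHartley m n * torusHartley m n = ((n : ℝ) ^ m) • 1 := by
  ext x y
  simp only [torusHartley, Matrix.mul_apply, Matrix.of_apply, ← Finset.prod_mul_distrib]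
  have h := Finset.prod_univ_sum (fun _ : Fin m => (Finset.univ : Finset (ZMod n)))
    (fun i k => hartley n (x i * k) * hartley n (k * y i))
  rw [Fintype.piFinset_univ] at h
  rw [← h]
  simp_rw [sum_hartley_mul_hartley]
  rw [Matrix.smul_apply, Matrix.one_apply]
  split_ifs with hxy
  · subst hxy
    simp
  · obtain ⟨i, hi⟩ := Function.ne_iff.mp hxy
    rw [Finset.prod_eq_zero (Finset.mem_univ i) (if_neg hi)]
    simp

theorem torusLaplacian_torusHartley (m n : ℕ) [NeZero n] (k : Fin m → ZMod n) :
    torusLaplacian m n (fun x => torusHartley m n x k) =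
      torusEigenvalue m n k • fun x => torusHartley m n x k := by
  funext x
  have hupd : ∀ (i : Fin m) (t : ZMod n), torusHartley m n (Function.update x i t) k =
      hartley n (t * k i) * ∏ j ∈ Finset.univ.erase i, hartley n (x j * k j) := by
    intro i t
    simp only [torusHartley, Matrix.of_apply]
    rw [← Finset.mul_prod_erase Finset.univ _ (Finset.mem_univ i), Function.update_self]
    congr 1
    refine Finset.prod_congr rfl fun j hj => ?_
    rw [Function.update_of_ne (Finset.ne_of_mem_erase hj)]
  have hx : ∀ i, torusHartley m n x k =
      hartley n (x i * k i) * ∏ j ∈ Finset.univ.erase i, hartley n (x j * k j) := by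
    intro i
    rw [← hupd, Function.update_eq_self]
  change (∑ i : Fin m, (n : ℝ) ^ 2 / (4 * Real.pi ^ 2) *
    ((torusHartley m n (Function.update x i (x i)) k -
      torusHartley m n (Function.update x i (x i - 1)) k) +
      (torusHartley m n (Function.update x i (x i)) k -
      torusHartley m n (Function.update x i (x i + 1)) k))) =
      torusEigenvalue m n k * torusHartley m n x k
  rw [torusEigenvalue, Finset.sum_mul]
  refine Finset.sum_congr rfl fun i _ => ?_
  rw [hupd, hupd, hupd, hx i]
  have h := hartley_add_add_hartley_sub n (x i * k i) (k i)
  rw [show x i * k i + k i = (x i + 1) * k i by ring,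
    show x i * k i - k i = (x i - 1) * k i by ring] at h
  generalize (∏ j ∈ Finset.univ.erase i, hartley n (x j * k j)) = q
  have h2 : hartley n ((x i + 1) * k i) =
    2 * cosMod n (k i) * hartley n (x i * k i) - hartley n ((x i - 1) * k i) := by linarith
  rw [h2]
  field_simp
  ring

theorem shiftedLaplacian_mul_torusHartley (m n : ℕ) [NeZero n] (z : ℝ) :
    shiftedLaplacian m n z * Matrix.toLin' (torusHartley m n) =
      Matrix.toLin' (torusHartley m n) *
        Matrix.toLin' (Matrix.diagonal fun k => torusEigenvalue m n k + z ^ 2) := by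
  apply (Pi.basisFun ℝ (Fin m → ZMod n)).ext
  intro k
  have h1 : Matrix.toLin' (torusHartley m n) (Pi.basisFun ℝ (Fin m → ZMod n) k) =
      fun x => torusHartley m n x k := by
    rw [Pi.basisFun_apply, Matrix.toLin'_apply, Matrix.mulVec_single_one]
    rfl
  have h2 : Matrix.toLin' (Matrix.diagonal fun k => torusEigenvalue m n k + z ^ 2)
      (Pi.basisFun ℝ (Fin m → ZMod n) k) =
      (torusEigenvalue m n k + z ^ 2) • Pi.basisFun ℝ (Fin m → ZMod n) k := by
    rw [Pi.basisFun_apply, Matrix.toLin'_apply, Matrix.diagonal_mulVec_single,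
      ← Pi.single_smul', smul_eq_mul]
  rw [Module.End.mul_apply, Module.End.mul_apply, h1, h2, map_smul, h1, shiftedLaplacian,
    LinearMap.add_apply, torusLaplacian_torusHartley, LinearMap.smul_apply, Module.End.one_apply,
    add_smul]

theorem cosMod_le_one (n : ℕ) [NeZero n] (t : ZMod n) : cosMod n t ≤ 1 := by
  refine (Complex.re_le_norm _).trans ?_
  rw [ZMod.stdAddChar_apply, Circle.norm_coe]

theorem torusEigenvalue_nonneg (m n : ℕ) [NeZero n] (k : Fin m → ZMod n) :
    0 ≤ torusEigenvalue m n k :=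
  Finset.sum_nonneg fun i _ => mul_nonneg (by positivity) (by linarith [cosMod_le_one n (k i)])

theorem resolventTrace_eq_sum (m n : ℕ) [NeZero n] (z : ℝ) (hz : 0 < z) :
    resolventTrace m n z = ∑ k : Fin m → ZMod n, ((torusEigenvalue m n k + z ^ 2) ^ m)⁻¹ := by
  set A := shiftedLaplacian m n z
  set L := Matrix.toLin' (torusHartley m n)
  set D := Matrix.toLin' (Matrix.diagonal fun k => torusEigenvalue m n k + z ^ 2)
  set E := Matrix.toLin' (Matrix.diagonal fun k => (torusEigenvalue m n k + z ^ 2)⁻¹)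
  have hpos : ∀ k, 0 < torusEigenvalue m n k + z ^ 2 := fun k =>
    add_pos_of_nonneg_of_pos (torusEigenvalue_nonneg m n k) (by positivity)
  have hA : IsUnit A := isUnit_shiftedLaplacian m n (NeZero.pos n) z hz
  have hDE : D * E = 1 := by
    change Matrix.toLin' _ ∘ₗ Matrix.toLin' _ = _
    rw [← Matrix.toLin'_mul, Matrix.diagonal_mul_diagonal]
    simp_rw [fun k => mul_inv_cancel₀ (hpos k).ne']
    rw [Matrix.diagonal_one, Matrix.toLin'_one]
    rfl
  have hLL : L * L = ((n : ℝ) ^ m) • 1 := by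
    change Matrix.toLin' _ ∘ₗ Matrix.toLin' _ = _
    rw [← Matrix.toLin'_mul, torusHartley_mul_self, map_smul, Matrix.toLin'_one]
    rfl
  have hAL : A * L = L * D := shiftedLaplacian_mul_torusHartley m n z
  have h1 : Ring.inverse A * L = L * E := by
    calc Ring.inverse A * L = Ring.inverse A * (L * (D * E)) := by rw [hDE, mul_one]
      _ = Ring.inverse A * A * (L * E) := by rw [← mul_assoc L, ← hAL]; simp only [mul_assoc]
      _ = L * E := by rw [Ring.inverse_mul_cancel _ hA, one_mul]
  have h2 : ∀ j : ℕ, Ring.inverse A ^ j * L = L * E ^ j := by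
    intro j
    induction j with
    | zero => simp
    | succ j ih => rw [pow_succ, mul_assoc, h1, ← mul_assoc, ih, mul_assoc, ← pow_succ]
  have hE : ∀ j : ℕ, E ^ j =
      Matrix.toLin' (Matrix.diagonal fun k => ((torusEigenvalue m n k + z ^ 2) ^ j)⁻¹) := by
    intro j
    induction j with
    | zero => simp; rfl
    | succ j ih =>
      rw [pow_succ, ih]
      change Matrix.toLin' _ ∘ₗ Matrix.toLin' _ = _
      rw [← Matrix.toLin'_mul, Matrix.diagonal_mul_diagonal]
      simp_rw [pow_succ, mul_inv]
  have hn : ((n : ℝ) ^ m) ≠ 0 := pow_ne_zero _ (NeZero.ne _)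
  have h3 : ((n : ℝ) ^ m) • Ring.inverse A ^ m = L * E ^ m * L := by
    rw [← h2, mul_assoc, hLL, mul_smul_comm, mul_one]
  have h4 : LinearMap.trace ℝ _ (((n : ℝ) ^ m) • Ring.inverse A ^ m) =
      (n : ℝ) ^ m * LinearMap.trace ℝ _ (E ^ m) := by
    rw [h3, LinearMap.trace_mul_comm, ← mul_assoc, hLL, smul_mul_assoc, one_mul, map_smul,
      smul_eq_mul]
  rw [map_smul, smul_eq_mul] at h4
  change LinearMap.trace ℝ _ (Ring.inverse A ^ m) = _
  rw [mul_left_cancel₀ hn h4, hE, Matrix.trace_toLin'_eq, Matrix.trace_diagonal]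

/-! ### Exponential accuracy of the trapezoidal rule for the heat kernel on the circle -/

/-- The heat kernel of `ℤ` on the diagonal, as a circle average. -/
noncomputable def circleHeat (y : ℝ) : ℝ :=
  (2 * Real.pi)⁻¹ * ∫ x in (0 : ℝ)..(2 * Real.pi), Real.exp (-(y * (1 - Real.cos x)))

/-- The heat trace of the (unnormalized) Laplacian of `ℤ/nℤ`. -/
noncomputable def discreteHeat (n : ℕ) [NeZero n] (y : ℝ) : ℝ :=
  ∑ k : ZMod n, Real.exp (-(y * (1 - cosMod n k)))

/-- The Laurent polynomial exponential whose Laurent coefficients are Bessel functions. -/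
noncomputable def besselIntegrand (y : ℝ) (j : ℤ) (w : ℂ) : ℂ :=
  w ^ (-j) * Complex.exp (y / 2 * (w + w⁻¹))

theorem circleMap_integral_besselIntegrand_eq_of_le (y : ℝ) (j : ℤ) {r R : ℝ} (hr : 0 < r)
    (hrR : r ≤ R) :
    ∫ θ in (0 : ℝ)..(2 * Real.pi), besselIntegrand y j (circleMap 0 R θ) =
      ∫ θ in (0 : ℝ)..(2 * Real.pi), besselIntegrand y j (circleMap 0 r θ) := by
  have hform : ∀ ρ : ℝ, 0 < ρ →
      (∮ z in C(0, ρ), besselIntegrand y j z * z⁻¹) =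
        Complex.I * ∫ θ in (0 : ℝ)..(2 * Real.pi), besselIntegrand y j (circleMap 0 ρ θ) := by
    intro ρ hρ
    rw [circleIntegral, ← intervalIntegral.integral_const_mul]
    refine intervalIntegral.integral_congr fun θ _ => ?_
    have : circleMap 0 ρ θ ≠ 0 := circleMap_ne_center hρ.ne'
    simp only [deriv_circleMap, smul_eq_mul]
    field_simp
  have hd : ∀ z : ℂ, z ≠ 0 → DifferentiableAt ℂ (fun z => besselIntegrand y j z * z⁻¹) z := by
    intro z hz
    unfold besselIntegrand
    have h1 : DifferentiableAt ℂ (fun z : ℂ => z ^ (-j)) z := differentiableAt_zpow.2 (Or.inl hz)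
    have h2 : DifferentiableAt ℂ (fun z : ℂ => z⁻¹) z := differentiableAt_inv hz
    exact (h1.mul (((differentiableAt_id.add h2).const_mul _).cexp)).mul h2
  have hmain := Complex.circleIntegral_eq_of_differentiable_on_annulus_off_countable
    (c := 0) hr hrR (f := fun z => besselIntegrand y j z * z⁻¹) Set.countable_empty
    (fun z hz => (hd z (by
      rintro rfl
      exact hz.2 (Metric.mem_ball_self hr))).continuousAt.continuousWithinAt)
    (fun z hz => hd z (by
      rintro rfl
      exact hz.1.2 (Metric.mem_closedBall_self hr.le)))
  rw [hform R (hr.trans_le hrR), hform r hr] at hmain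
  exact mul_left_cancel₀ Complex.I_ne_zero hmain

theorem circleMap_integral_besselIntegrand_eq (y : ℝ) (j : ℤ) {r R : ℝ} (hr : 0 < r)
    (hR : 0 < R) :
    ∫ θ in (0 : ℝ)..(2 * Real.pi), besselIntegrand y j (circleMap 0 R θ) =
      ∫ θ in (0 : ℝ)..(2 * Real.pi), besselIntegrand y j (circleMap 0 r θ) := by
  rcases le_total r R with h | h
  · exact circleMap_integral_besselIntegrand_eq_of_le y j hr h
  · exact (circleMap_integral_besselIntegrand_eq_of_le y j hR h).symm

theorem circleMap_exp_add_inv (a θ : ℝ) :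
    circleMap 0 (Real.exp a) θ + (circleMap 0 (Real.exp a) θ)⁻¹ =
      2 * Complex.cosh (a + θ * Complex.I) := by
  rw [circleMap, zero_add, Complex.ofReal_exp, ← Complex.exp_add, ← Complex.exp_neg,
    Complex.two_cosh]

theorem norm_besselIntegrand_circleMap_exp (y : ℝ) (j : ℤ) (a θ : ℝ) :
    ‖besselIntegrand y j (circleMap 0 (Real.exp a) θ)‖ =
      Real.exp (-(j * a)) * Real.exp (y * (Real.cosh a * Real.cos θ)) := by
  rw [besselIntegrand, norm_mul, circleMap_exp_add_inv, Complex.norm_exp, norm_zpow,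
    norm_circleMap_zero, abs_of_pos (Real.exp_pos a), ← Real.rpow_intCast, ← Real.exp_mul]
  congr 2
  · push_cast
    ring
  · rw [show (y : ℂ) / 2 * (2 * Complex.cosh (a + θ * Complex.I)) =
      (y : ℂ) * Complex.cosh (a + θ * Complex.I) by ring, Complex.re_ofReal_mul,
      Complex.cosh_add, Complex.cosh_mul_I, Complex.sinh_mul_I]
    congr 1
    rw [← Complex.ofReal_cosh, ← Complex.ofReal_cos, ← Complex.ofReal_sinh, ← Complex.ofReal_sin]
    simp [Complex.cos_ofReal_re]

theorem besselIntegrand_circleMap_one (y : ℝ) (j : ℤ) (θ : ℝ) :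
    besselIntegrand y j (circleMap 0 1 θ) =
      Complex.exp (-(j * θ * Complex.I)) * Complex.exp (y * Complex.cos θ) := by
  have h := circleMap_exp_add_inv 0 θ
  rw [Real.exp_zero] at h
  rw [besselIntegrand, h, circleMap]
  simp only [Complex.ofReal_zero, zero_add, Complex.cosh_mul_I, Complex.ofReal_one, one_mul]
  rw [← Complex.exp_int_mul]
  congr 2
  · push_cast
    ring
  · ring

theorem intervalIntegrable_exp_neg_mul_one_sub_cos (y a b : ℝ) :
    IntervalIntegrable (fun x => Real.exp (-(y * (1 - Real.cos x)))) MeasureTheory.volume a b :=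
  Continuous.intervalIntegrable (by fun_prop) _ _

/-- The `j`-th Fourier coefficient of the heat kernel symbol on the circle. -/
noncomputable def heatCoeff (y : ℝ) (j : ℤ) : ℂ :=
  (2 * Real.pi : ℝ)⁻¹ * ∫ x in (0 : ℝ)..(2 * Real.pi),
    Complex.exp (-(j * x * Complex.I)) * Complex.exp (-(y * (1 - Complex.cos x)))

theorem heatCoeff_zero (y : ℝ) : heatCoeff y 0 = circleHeat y := by
  rw [heatCoeff, circleHeat, Complex.ofReal_mul, ← intervalIntegral.integral_ofReal]
  congr 2
  funext x
  simp

theorem norm_heatCoeff_le {y : ℝ} (hy : 0 ≤ y) (j : ℤ) (a : ℝ) :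
    ‖heatCoeff y j‖ ≤ Real.exp (-(j * a)) * (Real.exp (y * (Real.cosh a - 1)) * circleHeat y) := by
  have h1 : ∫ x in (0 : ℝ)..(2 * Real.pi),
      Complex.exp (-(j * x * Complex.I)) * Complex.exp (-(y * (1 - Complex.cos x))) =
      (Real.exp (-y) : ℝ) *
        ∫ θ in (0 : ℝ)..(2 * Real.pi), besselIntegrand y j (circleMap 0 (Real.exp a) θ) := by
    rw [circleMap_integral_besselIntegrand_eq y j one_pos (Real.exp_pos a),
      ← intervalIntegral.integral_const_mul]
    refine intervalIntegral.integral_congr fun θ _ => ?_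
    simp only [besselIntegrand_circleMap_one, Complex.ofReal_exp, ← Complex.exp_add]
    congr 1
    push_cast
    ring
  have hpi : (0 : ℝ) ≤ 2 * Real.pi := by positivity
  have h2 : ‖∫ θ in (0 : ℝ)..(2 * Real.pi),
      besselIntegrand y j (circleMap 0 (Real.exp a) θ)‖ ≤
      ∫ θ in (0 : ℝ)..(2 * Real.pi),
        Real.exp (-(j * a)) * Real.exp (y * (Real.cosh a * Real.cos θ)) := by
    refine (intervalIntegral.norm_integral_le_integral_norm hpi).trans_eq ?_
    simp_rw [norm_besselIntegrand_circleMap_exp]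
  have h3 : ∫ θ in (0 : ℝ)..(2 * Real.pi),
        Real.exp (-(j * a)) * Real.exp (y * (Real.cosh a * Real.cos θ)) ≤
      ∫ θ in (0 : ℝ)..(2 * Real.pi), (Real.exp (-(j * a)) * Real.exp (y * Real.cosh a)) *
        Real.exp (-(y * (1 - Real.cos θ))) := by
    refine intervalIntegral.integral_mono_on hpi
      (Continuous.intervalIntegrable (by fun_prop) _ _)
      (Continuous.intervalIntegrable (by fun_prop) _ _) fun θ _ => ?_
    rw [mul_assoc]
    refine mul_le_mul_of_nonneg_left ?_ (Real.exp_pos _).le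
    rw [← Real.exp_add]
    refine Real.exp_le_exp.2 ?_
    nlinarith [mul_nonneg hy (mul_nonneg (sub_nonneg.2 (Real.one_le_cosh a))
      (sub_nonneg.2 (Real.cos_le_one θ)))]
  have h4 := h2.trans h3
  rw [intervalIntegral.integral_const_mul] at h4
  rw [heatCoeff, h1, norm_mul, norm_mul, Complex.norm_real, Complex.norm_real, Real.norm_eq_abs,
    Real.norm_eq_abs, abs_of_pos (Real.exp_pos _), abs_of_pos (by positivity), circleHeat,
    mul_sub, mul_one, Real.exp_sub]
  refine (mul_le_mul_of_nonneg_left (mul_le_mul_of_nonneg_left h4 (Real.exp_pos (-y)).le)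
    (by positivity : (0 : ℝ) ≤ (2 * Real.pi)⁻¹)).trans_eq ?_
  rw [Real.exp_neg y]
  ring

theorem circleHeat_nonneg (y : ℝ) : 0 ≤ circleHeat y :=
  mul_nonneg (by positivity) (intervalIntegral.integral_nonneg (by positivity)
    fun _ _ => (Real.exp_pos _).le)

theorem hasSum_pow_natAbs {r : ℝ} (h0 : 0 ≤ r) (h1 : r < 1) :
    HasSum (fun l : ℤ => if l = 0 then 0 else r ^ l.natAbs) (2 * (r / (1 - r))) := by
  have hg : HasSum (fun k : ℕ => r ^ (k + 1)) (r / (1 - r)) := by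
    simpa [pow_succ', div_eq_mul_inv] using (hasSum_geometric_of_lt_one h0 h1).mul_left r
  have hg' : ∀ f : ℕ → ℝ, (∀ k, f k = r ^ (k + 1)) → HasSum f (r / (1 - r)) := by
    intro f hf
    rwa [funext hf]
  rw [two_mul]
  refine HasSum.of_nat_of_neg_add_one ?_ ?_
  · rw [← hasSum_nat_add_iff' 1]
    simp only [Nat.cast_add, Nat.cast_one, Finset.range_one, Finset.sum_singleton, Nat.cast_zero,
      if_true, sub_zero]
    exact hg' _ fun k => by rw [if_neg (by omega)]; congr 1
  · exact hg' _ fun k => by rw [if_neg (by omega)]; congr 1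

theorem cosMod_eq_cos (n : ℕ) [NeZero n] (k : ZMod n) :
    cosMod n k = Real.cos (2 * Real.pi * k.val / n) := by
  have h := ZMod.stdAddChar_coe (N := n) (k.val : ℤ)
  rw [Int.cast_natCast, ZMod.natCast_zmod_val] at h
  rw [cosMod, h, show (2 * (Real.pi : ℂ) * Complex.I * ((k.val : ℤ) : ℂ) / (n : ℂ)) =
    ((2 * Real.pi * k.val / n : ℝ) : ℂ) * Complex.I by push_cast; ring, Complex.exp_ofReal_mul_I_re]

theorem hasSum_heatCoeff_of_summable {y : ℝ} (hs : Summable (heatCoeff y)) (x : ℝ) :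
    HasSum (fun j : ℤ => heatCoeff y j * Complex.exp (j * x * Complex.I))
      (Real.exp (-(y * (1 - Real.cos x))) : ℝ) := by
  have : Fact (0 < 2 * Real.pi) := ⟨by positivity⟩
  let f : C(AddCircle (2 * Real.pi), ℂ) :=
    ⟨fun t => ((Real.exp (-(y * (1 - Real.Angle.cos t))) : ℝ) : ℂ), by
      have : Continuous fun t : AddCircle (2 * Real.pi) => Real.Angle.cos t :=
        Real.Angle.continuous_cos
      fun_prop⟩
  have hc : fourierCoeff f = heatCoeff y := by
    funext j
    rw [fourierCoeff_eq_intervalIntegral _ _ 0, heatCoeff, zero_add, one_div,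
      Complex.real_smul]
    congr 2
    funext x
    rw [fourier_coe_apply, smul_eq_mul]
    congr 1
    · congr 1
      have : (Real.pi : ℂ) ≠ 0 := by exact_mod_cast Real.pi_ne_zero
      push_cast
      field_simp
    · change ((Real.exp (-(y * (1 - Real.Angle.cos (x : Real.Angle)))) : ℝ) : ℂ) = _
      rw [Real.Angle.cos_coe]
      push_cast
      rfl
  have h := has_pointwise_sum_fourier_series_of_summable (f := f) (by rwa [hc])
    (x : AddCircle (2 * Real.pi))
  rw [hc] at h
  have hfx : f (x : AddCircle (2 * Real.pi)) = (Real.exp (-(y * (1 - Real.cos x))) : ℝ) := by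
    change ((Real.exp (-(y * (1 - Real.Angle.cos (x : Real.Angle)))) : ℝ) : ℂ) = _
    rw [Real.Angle.cos_coe]
  rw [hfx] at h
  convert h using 2 with j
  rw [fourier_coe_apply, smul_eq_mul]
  congr 2
  have : (Real.pi : ℂ) ≠ 0 := by exact_mod_cast Real.pi_ne_zero
  push_cast
  field_simp

theorem stdAddChar_mul_intCast (n : ℕ) [NeZero n] (k : ZMod n) (j : ℤ) :
    (ZMod.stdAddChar (k * (j : ZMod n)) : ℂ) =
      Complex.exp (j * (2 * Real.pi * k.val / n : ℝ) * Complex.I) := by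
  have h := ZMod.stdAddChar_coe (N := n) (k.val * j : ℤ)
  rw [Int.cast_mul, Int.cast_natCast, ZMod.natCast_zmod_val] at h
  rw [h]
  congr 1
  push_cast
  ring

theorem summable_heatCoeff {y : ℝ} (hy : 0 ≤ y) : Summable (heatCoeff y) := by
  set M := Real.exp (y * (Real.cosh 1 - 1)) * circleHeat y
  have hM : 0 ≤ M := mul_nonneg (Real.exp_pos _).le (circleHeat_nonneg y)
  have hs : Summable fun j : ℤ => M * (Real.exp (-1)) ^ j.natAbs := by
    refine Summable.mul_left _ ?_
    have h := summable_geometric_of_lt_one (Real.exp_pos (-1)).le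
      (Real.exp_lt_one_iff.2 (by norm_num : (-1 : ℝ) < 0))
    exact Summable.of_nat_of_neg (by simp [h]) (by simp [h])
  refine Summable.of_norm_bounded hs fun j => ?_
  rw [← Real.exp_nat_mul, mul_comm M]
  rcases le_total 0 j with hj | hj
  · have h := norm_heatCoeff_le hy j 1
    have e : ((j.natAbs : ℕ) : ℝ) = j := by
      rw [Nat.cast_natAbs, abs_of_nonneg hj]
    rwa [e, show (j : ℝ) * -1 = -(j * 1) by ring]
  · have h := norm_heatCoeff_le hy j (-1)
    have e : ((j.natAbs : ℕ) : ℝ) = -j := by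
      rw [Nat.cast_natAbs, abs_of_nonpos hj, Int.cast_neg]
    rw [Real.cosh_neg] at h
    rwa [e, show -(j : ℝ) * -1 = -(j * -1) by ring]

theorem hasSum_discreteHeat (n : ℕ) [NeZero n] {y : ℝ} (hy : 0 ≤ y) :
    HasSum (fun l : ℤ => (n : ℂ) * heatCoeff y (n * l)) (discreteHeat n y : ℝ) := by
  have h1 : HasSum (fun j : ℤ => ∑ k : ZMod n,
      heatCoeff y j * Complex.exp (j * (2 * Real.pi * k.val / n : ℝ) * Complex.I))
      (∑ k : ZMod n, ((Real.exp (-(y * (1 - Real.cos (2 * Real.pi * k.val / n)))) : ℝ) : ℂ)) :=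
    hasSum_sum fun k _ => hasSum_heatCoeff_of_summable (summable_heatCoeff hy) _
  simp_rw [← stdAddChar_mul_intCast, ← Finset.mul_sum,
    AddChar.sum_mulShift _ (ZMod.isPrimitive_stdAddChar n), ← cosMod_eq_cos, ZMod.card] at h1
  rw [← Complex.ofReal_sum] at h1
  have hn : (n : ℤ) ≠ 0 := by exact_mod_cast NeZero.ne n
  have hinj : Function.Injective fun l : ℤ => (n : ℤ) * l := mul_right_injective₀ hn
  rw [← hinj.hasSum_iff] at h1
  · convert h1 using 2 with l
    · simp [mul_comm]
    · rfl
  · intro j hj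
    have hj' : ((j : ℤ) : ZMod n) ≠ 0 := by
      rw [Ne, ZMod.intCast_zmod_eq_zero_iff_dvd]
      rintro ⟨l, hl⟩
      exact hj ⟨l, hl.symm⟩
    rw [if_neg hj']
    simp

theorem abs_discreteHeat_sub_le (n : ℕ) [NeZero n] {y a : ℝ} (hy : 0 ≤ y) (ha : 0 < a) :
    |discreteHeat n y - n * circleHeat y| ≤
      2 * (n * circleHeat y) * (Real.exp (y * (Real.cosh a - 1)) / (Real.exp (n * a) - 1)) := by
  have hn : (0 : ℝ) < n := by exact_mod_cast NeZero.pos n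
  set M := Real.exp (y * (Real.cosh a - 1)) * circleHeat y
  set r := Real.exp (-(n * a))
  have hr1 : r < 1 := Real.exp_lt_one_iff.2 (by nlinarith [mul_pos hn ha])
  have h1 := (hasSum_discreteHeat n hy).sub (hasSum_ite_eq (0 : ℤ) ((n : ℂ) * heatCoeff y 0))
  have h2 := (hasSum_pow_natAbs (Real.exp_pos _).le hr1).mul_left (n * M)
  have h3 := h1.norm_le_of_bounded h2 fun l => ?_
  · rw [heatCoeff_zero] at h3
    have h4 : ‖((discreteHeat n y : ℝ) : ℂ) - (n : ℂ) * (circleHeat y : ℝ)‖ =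
        |discreteHeat n y - n * circleHeat y| := by
      rw [← Real.norm_eq_abs, ← Complex.norm_real]
      push_cast
      rfl
    rw [h4] at h3
    refine h3.trans_eq ?_
    have h5 : r / (1 - r) = 1 / (Real.exp (n * a) - 1) := by
      have : Real.exp (n * a) - 1 ≠ 0 := by
        have := Real.one_lt_exp_iff.2 (by positivity : 0 < n * a)
        linarith
      rw [div_eq_div_iff (by linarith) this]
      simp only [r, Real.exp_neg]
      field_simp
    rw [h5]
    simp only [M]
    ring
  · rcases eq_or_ne l 0 with rfl | hl
    · simp
    · rw [if_neg hl, if_neg hl, sub_zero, norm_mul, Complex.norm_natCast, mul_assoc]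
      refine mul_le_mul_of_nonneg_left ?_ hn.le
      rw [← Real.exp_nat_mul, mul_comm M]
      rcases le_total 0 l with hj | hj
      · have h := norm_heatCoeff_le hy (n * l) a
        have e : ((l.natAbs : ℕ) : ℝ) = l := by
          rw [Nat.cast_natAbs, abs_of_nonneg hj]
        push_cast at h
        rwa [e, show (l : ℝ) * -(n * a) = -(n * l * a) by ring]
      · have h := norm_heatCoeff_le hy (n * l) (-a)
        have e : ((l.natAbs : ℕ) : ℝ) = -l := by
          rw [Nat.cast_natAbs, abs_of_nonpos hj, Int.cast_neg]
        push_cast at h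
        rw [Real.cosh_neg] at h
        rwa [e, show -(l : ℝ) * -(n * a) = -(n * l * -a) by ring]

theorem circleHeat_le_one {y : ℝ} (hy : 0 ≤ y) : circleHeat y ≤ 1 := by
  have hpi : (0 : ℝ) < 2 * Real.pi := by positivity
  have h : ∫ x in (0 : ℝ)..(2 * Real.pi), Real.exp (-(y * (1 - Real.cos x))) ≤
      ∫ x in (0 : ℝ)..(2 * Real.pi), (1 : ℝ) := by
    refine intervalIntegral.integral_mono_on hpi.le (intervalIntegrable_exp_neg_mul_one_sub_cos ..)
      (by simp) fun x _ => ?_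
    rw [Real.exp_le_one_iff]
    nlinarith [mul_nonneg hy (sub_nonneg.2 (Real.cos_le_one x))]
  rw [intervalIntegral.integral_const, sub_zero, smul_eq_mul, mul_one] at h
  rw [circleHeat, inv_mul_le_iff₀ hpi, mul_one]
  exact h

theorem mul_circleHeat_le {v : ℝ} (hv : 0 < v) : v * circleHeat (v ^ 2 / 2) ≤ 1 := by
  have hpi := Real.pi_pos
  set b := v ^ 2 / Real.pi ^ 2
  have hb : 0 < b := by positivity
  have hper : Function.Periodic (fun x => Real.exp (-(v ^ 2 / 2 * (1 - Real.cos x))))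
      (2 * Real.pi) := fun x => by simp only [Real.cos_add_two_pi]
  have h1 := hper.intervalIntegral_add_eq 0 (-Real.pi)
  rw [zero_add, show -Real.pi + 2 * Real.pi = Real.pi by ring] at h1
  have h2 : ∫ x in (-Real.pi)..Real.pi, Real.exp (-(v ^ 2 / 2 * (1 - Real.cos x))) ≤
      ∫ x in (-Real.pi)..Real.pi, Real.exp (-b * x ^ 2) := by
    refine intervalIntegral.integral_mono_on (by linarith)
      (intervalIntegrable_exp_neg_mul_one_sub_cos ..)
      (Continuous.intervalIntegrable (by fun_prop) _ _) fun x hx => ?_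
    have h := Real.cos_le_one_sub_mul_cos_sq (abs_le.2 hx)
    refine Real.exp_le_exp.2 ?_
    have h' : v ^ 2 / 2 * (2 / Real.pi ^ 2 * x ^ 2) ≤ v ^ 2 / 2 * (1 - Real.cos x) :=
      mul_le_mul_of_nonneg_left (by linarith) (by positivity)
    have h'' : v ^ 2 / 2 * (2 / Real.pi ^ 2 * x ^ 2) = b * x ^ 2 := by
      simp only [b]
      ring
    linarith
  have h3 : ∫ x in (-Real.pi)..Real.pi, Real.exp (-b * x ^ 2) ≤ Real.sqrt (Real.pi / b) := by
    rw [← integral_gaussian, intervalIntegral.integral_of_le (by linarith)]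
    exact MeasureTheory.setIntegral_le_integral (integrable_exp_neg_mul_sq hb)
      (Eventually.of_forall fun x => (Real.exp_pos _).le)
  have h4 : Real.sqrt (Real.pi / b) = Real.sqrt Real.pi * Real.pi / v := by
    rw [show Real.pi / b = Real.pi * (Real.pi / v) ^ 2 by simp only [b]; field_simp,
      Real.sqrt_mul hpi.le, Real.sqrt_sq (by positivity), mul_div_assoc]
  have h5 : Real.sqrt Real.pi ≤ 2 := by
    rw [Real.sqrt_le_left (by norm_num)]
    linarith [Real.pi_le_four]
  rw [circleHeat, h1]
  have h6 := h2.trans (h3.trans_eq h4)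
  have h7 : Real.sqrt Real.pi * Real.pi / v ≤ 2 * Real.pi / v := by gcongr
  calc v * ((2 * Real.pi)⁻¹ * _) ≤ v * ((2 * Real.pi)⁻¹ * (2 * Real.pi / v)) := by
        gcongr
        exact h6.trans h7
    _ = 1 := by field_simp

theorem cosh_log_one_add_sub_one {x : ℝ} (hx : 0 < x) :
    Real.cosh (Real.log (1 + x)) - 1 = x ^ 2 / (2 * (1 + x)) := by
  rw [Real.cosh_log (by positivity)]
  field_simp
  ring

/-- The relative aliasing error of the trapezoidal rule on `ℤ/nℤ`, for a good choice of the
width of the strip of analyticity. -/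
theorem exists_aliasing_bound (n : ℕ) (hn : 0 < n) {t : ℝ} (ht : 0 < t) :
    ∃ a : ℝ, 0 < a ∧
      t * n ^ 2 / (2 * Real.pi ^ 2) * (Real.cosh a - 1) ≤ n / (t * n + 1) / 2 ∧
      (1 : ℝ) / (t * n + 1) ≤ a ∧ 1 + 1 / t ≤ Real.exp (n * a) ∧
      ∀ p : ℝ, 1 ≤ p → 1 + p * (1 / (t * n)) ≤ Real.exp (p * a) := by
  have hn' : (0 : ℝ) < n := by exact_mod_cast hn
  have hx : 0 < 1 / (t * n) := by positivity
  have hP : ∀ p : ℝ, 1 ≤ p → 1 + p * (1 / (t * n)) ≤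
      Real.exp (p * Real.log (1 + 1 / (t * n))) := by
    intro p hp
    rw [mul_comm p (Real.log _), ← Real.rpow_def_of_pos (by positivity)]
    exact one_add_mul_self_le_rpow_one_add (by linarith) hp
  refine ⟨Real.log (1 + 1 / (t * n)), Real.log_pos (by linarith), ?_, ?_, ?_, hP⟩
  · rw [cosh_log_one_add_sub_one hx]
    have : t * n ^ 2 / (2 * Real.pi ^ 2) * ((1 / (t * n)) ^ 2 / (2 * (1 + 1 / (t * n)))) =
        n / (t * n + 1) / 2 * (1 / (2 * Real.pi ^ 2)) := by
      field_simp
    rw [this]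
    refine mul_le_of_le_one_right (by positivity) ?_
    rw [div_le_one (by positivity)]
    nlinarith [Real.pi_gt_three]
  · have h := Real.one_sub_inv_le_log_of_pos (by positivity : 0 < 1 + 1 / (t * n))
    refine le_trans (le_of_eq ?_) h
    field_simp
    ring
  · have h := hP n (by exact_mod_cast hn)
    refine le_trans (le_of_eq ?_) h
    field_simp

theorem abs_pow_sub_pow_le_of_abs_sub_le {θ G X : ℝ} (m : ℕ) (hG : 0 ≤ G) (hX : 0 ≤ X)
    (h : |θ - G| ≤ 2 * G * X) : |θ ^ m - G ^ m| ≤ 2 * m * (G ^ m * X * (1 + 2 * X) ^ m) := by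
  rcases Nat.eq_zero_or_pos m with rfl | hm
  · simp
  have h1 : max |θ| |G| ≤ G * (1 + 2 * X) := by
    refine max_le ?_ ?_
    · have := abs_add_le (θ - G) G
      rw [sub_add_cancel, abs_of_nonneg hG] at this
      linarith
    · rw [abs_of_nonneg hG]
      nlinarith [mul_nonneg hG hX]
  calc |θ ^ m - G ^ m| ≤ |θ - G| * m * max |θ| |G| ^ (m - 1) := abs_pow_sub_pow_le ..
    _ ≤ (2 * G * X) * m * (G * (1 + 2 * X)) ^ (m - 1) := by gcongr
    _ = 2 * m * ((G * G ^ (m - 1)) * X * (1 + 2 * X) ^ (m - 1)) := by rw [mul_pow]; ring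
    _ ≤ 2 * m * (G ^ m * X * (1 + 2 * X) ^ m) := by
      rw [mul_pow_sub_one hm.ne']
      gcongr
      · linarith
      · omega

set_option maxHeartbeats 400000 in
theorem exists_abs_discreteHeat_pow_sub_le (m : ℕ) :
    ∃ C : ℝ, ∀ (n : ℕ) [NeZero n] (u : ℝ), 0 < u →
      |discreteHeat n ((u * n / Real.pi) ^ 2 / 2) ^ m -
        (n * circleHeat ((u * n / Real.pi) ^ 2 / 2)) ^ m| ≤ C * (u ^ 2 + u ^ (2 * m + 2)) := by
  set q := m + 2 with hq
  set e := Real.exp (2 * q)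
  set B := 2 * (2 * q : ℝ) ^ q
  have he : 0 < e := Real.exp_pos _
  have hB : 0 ≤ B := by positivity
  refine ⟨2 * m * (4 ^ m * 3 * 7 ^ m + (2 * q) ^ m * e * (1 + 2 * e) ^ m +
    4 ^ m * B * (1 + 2 * B) ^ m), ?_⟩
  intro n _ u hu
  have hnpos : 0 < n := NeZero.pos n
  have hn : (1 : ℝ) ≤ n := by exact_mod_cast hnpos
  have hn0 : (0 : ℝ) < n := by linarith
  have hpi := Real.pi_pos
  set y := (u * n / Real.pi) ^ 2 / 2 with hy
  have hy0 : 0 ≤ y := by positivity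
  have hyt : y = u ^ 2 * n ^ 2 / (2 * Real.pi ^ 2) := by
    rw [hy]
    field_simp
  set t := u ^ 2 with ht
  have ht0 : 0 < t := by positivity
  obtain ⟨a, ha, h1, h2, h3, h4⟩ := exists_aliasing_bound n hnpos ht0
  rw [← hyt] at h1
  set G := n * circleHeat y
  have hG : 0 ≤ G := mul_nonneg hn0.le (circleHeat_nonneg y)
  have hGn : G ≤ n := mul_le_of_le_one_right hn0.le (circleHeat_le_one hy0)
  have hGu : G ≤ 4 / u := by
    have h := mul_circleHeat_le (by positivity : 0 < u * n / Real.pi)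
    rw [le_div_iff₀ hu]
    have : u * n / Real.pi * circleHeat y = G * u / Real.pi := by simp only [G]; ring
    rw [← hy, this, div_le_one hpi] at h
    linarith [Real.pi_le_four]
  set X := Real.exp (y * (Real.cosh a - 1)) / (Real.exp (n * a) - 1)
  have hP : 1 / t ≤ Real.exp (n * a) - 1 := by linarith
  have hP0 : 0 < Real.exp (n * a) - 1 := lt_of_lt_of_le (by positivity) hP
  have hX : 0 ≤ X := by positivity
  have hmain := abs_pow_sub_pow_le_of_abs_sub_le m hG hX (abs_discreteHeat_sub_le n hy0 ha)
  have hXle : ∀ c : ℝ, y * (Real.cosh a - 1) ≤ c → X ≤ Real.exp c * t := by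
    intro c hc
    rw [div_le_iff₀ hP0]
    calc Real.exp (y * (Real.cosh a - 1)) ≤ Real.exp c := Real.exp_le_exp.2 hc
      _ = Real.exp c * t * (1 / t) := by field_simp
      _ ≤ _ := by gcongr
  refine hmain.trans ?_
  rw [mul_assoc (2 * (m : ℝ))]
  refine mul_le_mul_of_nonneg_left ?_ (by positivity)
  have hS : 0 ≤ u ^ 2 + u ^ (2 * m + 2) := by positivity
  have hu2 : t ≤ u ^ 2 + u ^ (2 * m + 2) := by
    have : 0 ≤ u ^ (2 * m + 2) := by positivity
    linarith
  have hu3 : t ^ (m + 1) ≤ u ^ 2 + u ^ (2 * m + 2) := by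
    rw [ht, ← pow_mul, mul_add, mul_one]
    have : 0 ≤ u ^ 2 := by positivity
    linarith
  have hT1 : 0 ≤ 4 ^ m * 3 * (7 : ℝ) ^ m := by positivity
  have hT2 : 0 ≤ (2 * (q : ℝ)) ^ m * e * (1 + 2 * e) ^ m := by positivity
  have hT3 : 0 ≤ 4 ^ m * B * (1 + 2 * B) ^ m := by positivity
  rcases le_total 1 t with htl | htl
  · have hu1 : 1 ≤ u := by
      by_contra hc
      have : u ^ 2 < 1 := by nlinarith
      linarith
    have hG4 : G ≤ 4 := hGu.trans (div_le_self (by norm_num) hu1)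
    have hX3 : X ≤ 3 * t := by
      refine (hXle 1 (h1.trans ?_)).trans ?_
      · rw [div_div, div_le_one (by positivity)]
        nlinarith
      · gcongr
        exact Real.exp_one_lt_three.le
    have : G ^ m * X * (1 + 2 * X) ^ m ≤ 4 ^ m * 3 * 7 ^ m * t ^ (m + 1) := by
      calc G ^ m * X * (1 + 2 * X) ^ m ≤ 4 ^ m * (3 * t) * (7 * t) ^ m := by
            gcongr
            linarith
        _ = _ := by rw [mul_pow]; ring
    refine this.trans (mul_le_mul ?_ hu3 (by positivity) (by positivity))
    linarith
  · rcases lt_or_ge n (2 * q) with hnq | hnq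
    · have hnq' : (n : ℝ) ≤ 2 * q := by exact_mod_cast hnq.le
      have hXe : X ≤ e * t := hXle _ <| by
        refine h1.trans ?_
        rw [div_div, div_le_iff₀ (by positivity)]
        nlinarith [mul_pos ht0 hn0]
      have hXe' : X ≤ e := hXe.trans (mul_le_of_le_one_right he.le htl)
      have : G ^ m * X * (1 + 2 * X) ^ m ≤ (2 * q) ^ m * e * (1 + 2 * e) ^ m * t := by
        calc G ^ m * X * (1 + 2 * X) ^ m ≤ (2 * q) ^ m * (e * t) * (1 + 2 * e) ^ m := by
              gcongr
              exact hGn.trans hnq'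
          _ = _ := by ring
      refine this.trans (mul_le_mul ?_ hu2 (by positivity) (by positivity))
      linarith
    · have hu1 : u ≤ 1 := by
        by_contra hc
        have : 1 < u ^ 2 := by nlinarith
        linarith
      have hq0 : (0 : ℝ) < 2 * q := by positivity
      have hq1 : (q : ℝ) ≠ 0 := fun h => by simp [h] at hq0
      have hnq' : 2 * (q : ℝ) ≤ n := by exact_mod_cast hnq
      set R := Real.exp (n * a / 2) with hR
      have hR0 : 0 < R := Real.exp_pos _
      have hRR : Real.exp (n * a) = R * R := by
        rw [hR, ← Real.exp_add]
        ring_nf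
      have hR2 : 2 ≤ R * R := by
        rw [← hRR]
        have : 1 ≤ 1 / t := by rwa [le_div_iff₀ ht0, one_mul]
        linarith
      have hRq : (1 / (2 * q * t)) ^ q ≤ R := by
        have h5 := h4 (n / (2 * q)) ((one_le_div hq0).2 hnq')
        have h6 : R = Real.exp (n / (2 * q) * a) ^ q := by
          rw [hR, ← Real.exp_nat_mul]
          congr 1
          field_simp
        rw [h6]
        refine pow_le_pow_left₀ (by positivity) (le_trans (le_of_eq ?_)
          (le_trans (le_add_of_nonneg_left zero_le_one) h5)) _
        have := hq0.ne'
        generalize 2 * (q : ℝ) = s at *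
        field_simp
      have hXR : X ≤ 2 / R := by
        rw [div_le_div_iff₀ hP0 hR0, hRR]
        have h7 : Real.exp (y * (Real.cosh a - 1)) ≤ R := by
          refine Real.exp_le_exp.2 (h1.trans ?_)
          have := mul_le_mul_of_nonneg_left h2 hn0.le
          rw [mul_one_div] at this
          linarith
        have := mul_le_mul_of_nonneg_right h7 hR0.le
        linarith
      have hXB : X ≤ B * t ^ q := by
        refine hXR.trans ?_
        rw [div_le_iff₀ hR0]
        calc (2 : ℝ) = B * t ^ q * (1 / (2 * q * t)) ^ q := by
              simp only [B]
              rw [mul_assoc, mul_assoc, ← mul_pow, ← mul_pow, ← mul_assoc, mul_one_div,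
                div_self (by positivity), one_pow, mul_one]
          _ ≤ B * t ^ q * R := by gcongr
      have hXB' : X ≤ B := hXB.trans (mul_le_of_le_one_right hB (pow_le_one₀ ht0.le htl))
      have : G ^ m * X * (1 + 2 * X) ^ m ≤ 4 ^ m * B * (1 + 2 * B) ^ m * t := by
        calc G ^ m * X * (1 + 2 * X) ^ m ≤ (4 / u) ^ m * (B * t ^ q) * (1 + 2 * B) ^ m := by
              gcongr
          _ = 4 ^ m * B * (1 + 2 * B) ^ m * (u ^ (m + 2) * t) := by
              have e1 : (4 / u) ^ m * u ^ m = 4 ^ m := by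
                rw [← mul_pow, div_mul_cancel₀ _ hu.ne']
              have e2 : t ^ q = u ^ m * (u ^ (m + 2) * t) := by
                rw [ht, ← pow_mul, hq]
                ring
              rw [e2, ← e1]
              ring
          _ ≤ 4 ^ m * B * (1 + 2 * B) ^ m * (1 * t) := by
              gcongr
              exact pow_le_one₀ hu.le hu1
          _ = _ := by rw [one_mul]
      refine this.trans (mul_le_mul ?_ hu2 (by positivity) (by positivity))
      linarith

/-! ### Comparison of the resolvent trace with the infinite-volume density -/

theorem continuous_circleHeat : Continuous circleHeat := by
  unfold circleHeat
  refine continuous_const.mul ?_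
  exact intervalIntegral.continuous_parametric_intervalIntegral_of_continuous'
    (f := fun y x => Real.exp (-(y * (1 - Real.cos x)))) (by fun_prop) _ _

theorem integrableOn_pow_mul_exp_neg_mul_sq (k : ℕ) {b : ℝ} (hb : 0 < b) :
    MeasureTheory.IntegrableOn (fun u : ℝ => u ^ k * Real.exp (-(u ^ 2 * b))) (Set.Ioi 0) := by
  have h := (integrable_rpow_mul_exp_neg_mul_sq hb
    (by linarith [k.cast_nonneg (α := ℝ)] : (-1 : ℝ) < k)).integrableOn (s := Set.Ioi 0)
  refine h.congr_fun (fun u _ => ?_) measurableSet_Ioi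
  simp only [Real.rpow_natCast]
  ring_nf

theorem integral_pow_odd_mul_exp_neg_mul_sq (j : ℕ) {b : ℝ} (hb : 0 < b) :
    ∫ u in Set.Ioi (0 : ℝ), u ^ (2 * j + 1) * Real.exp (-(u ^ 2 * b)) =
      j.factorial / 2 * (b ^ (j + 1))⁻¹ := by
  have h := integral_rpow_mul_exp_neg_mul_rpow (p := 2) (q := (2 * j + 1 : ℕ)) (b := b)
    (by norm_num) (by linarith [(2 * j + 1).cast_nonneg (α := ℝ)]) hb
  have e : (((2 * j + 1 : ℕ) : ℝ) + 1) / 2 = (j : ℝ) + 1 := by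
    push_cast
    ring
  rw [neg_div, e, Real.Gamma_nat_eq_factorial, Real.rpow_neg hb.le,
    show (j : ℝ) + 1 = ((j + 1 : ℕ) : ℝ) by push_cast; ring, Real.rpow_natCast] at h
  rw [show (j.factorial : ℝ) / 2 * (b ^ (j + 1))⁻¹ = (b ^ (j + 1))⁻¹ * (1 / 2) * j.factorial by ring,
    ← h]
  refine MeasureTheory.setIntegral_congr_fun measurableSet_Ioi fun u _ => ?_
  simp only [Real.rpow_natCast, Real.rpow_ofNat]
  ring_nf

/-- The Gaussian weight representing the `-(j+1)`-st power of the resolvent. -/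
noncomputable def resolventWeight (j : ℕ) (z u : ℝ) : ℝ :=
  u ^ (2 * j + 1) * Real.exp (-(u ^ 2 * z ^ 2))

/-- The leading term of the resolvent trace on `(ℤ/nℤ)^(j+1)`, i.e. the volume `n^(j+1)` times
the on-diagonal value on the infinite lattice, given by the heat kernel. -/
noncomputable def resolventDensity (j : ℕ) (z n : ℝ) : ℝ :=
  2 / j.factorial * ∫ u in Set.Ioi (0 : ℝ), resolventWeight j z u *
    (n * circleHeat ((u * n / Real.pi) ^ 2 / 2)) ^ (j + 1)

theorem sum_exp_neg_torusEigenvalue (m n : ℕ) [NeZero n] (u : ℝ) :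
    ∑ k : Fin m → ZMod n, Real.exp (-(u ^ 2 * torusEigenvalue m n k)) =
      discreteHeat n ((u * n / Real.pi) ^ 2 / 2) ^ m := by
  rw [discreteHeat, Fintype.sum_pow]
  refine Finset.sum_congr rfl fun k _ => ?_
  rw [← Real.exp_sum, torusEigenvalue, Finset.mul_sum, ← Finset.sum_neg_distrib]
  congr 1
  refine Finset.sum_congr rfl fun i _ => ?_
  have := Real.pi_ne_zero
  field_simp

theorem integrableOn_resolventWeight (j : ℕ) {z : ℝ} (hz : 0 < z) :
    MeasureTheory.IntegrableOn (resolventWeight j z) (Set.Ioi 0) :=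
  integrableOn_pow_mul_exp_neg_mul_sq _ (by positivity)

theorem resolventWeight_mul_exp (j : ℕ) (z u l : ℝ) :
    resolventWeight j z u * Real.exp (-(u ^ 2 * l)) =
      u ^ (2 * j + 1) * Real.exp (-(u ^ 2 * (l + z ^ 2))) := by
  rw [resolventWeight, mul_assoc, ← Real.exp_add]
  ring_nf

theorem resolventTrace_eq_integral (j n : ℕ) [NeZero n] {z : ℝ} (hz : 0 < z) :
    MeasureTheory.IntegrableOn (fun u => resolventWeight j z u *
      discreteHeat n ((u * n / Real.pi) ^ 2 / 2) ^ (j + 1)) (Set.Ioi 0) ∧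
    resolventTrace (j + 1) n z = 2 / j.factorial * ∫ u in Set.Ioi (0 : ℝ), resolventWeight j z u *
      discreteHeat n ((u * n / Real.pi) ^ 2 / 2) ^ (j + 1) := by
  have hpos : ∀ k, 0 < torusEigenvalue (j + 1) n k + z ^ 2 := fun k =>
    add_pos_of_nonneg_of_pos (torusEigenvalue_nonneg _ n k) (by positivity)
  simp_rw [← sum_exp_neg_torusEigenvalue, Finset.mul_sum, resolventWeight_mul_exp]
  refine ⟨MeasureTheory.integrable_finsetSum _ fun k _ =>
    integrableOn_pow_mul_exp_neg_mul_sq _ (hpos k), ?_⟩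
  rw [MeasureTheory.integral_finsetSum _ fun k _ =>
    integrableOn_pow_mul_exp_neg_mul_sq _ (hpos k), Finset.mul_sum, resolventTrace_eq_sum _ _ _ hz]
  refine Finset.sum_congr rfl fun k _ => ?_
  rw [integral_pow_odd_mul_exp_neg_mul_sq _ (hpos k)]
  have : (j.factorial : ℝ) ≠ 0 := by exact_mod_cast j.factorial_ne_zero
  field_simp

theorem integrableOn_resolventWeight_mul_circleHeat (j : ℕ) {z : ℝ} (hz : 0 < z) (n : ℝ) :
    MeasureTheory.IntegrableOn (fun u => resolventWeight j z u *
      (n * circleHeat ((u * n / Real.pi) ^ 2 / 2)) ^ (j + 1)) (Set.Ioi 0) := by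
  refine MeasureTheory.Integrable.mul_bdd (c := |n| ^ (j + 1))
    (integrableOn_resolventWeight j hz) ?_ ?_
  · have := continuous_circleHeat
    exact Continuous.aestronglyMeasurable (by fun_prop)
  · refine Eventually.of_forall fun u => ?_
    rw [norm_pow, Real.norm_eq_abs, abs_mul, abs_of_nonneg (circleHeat_nonneg _)]
    exact pow_le_pow_left₀ (mul_nonneg (abs_nonneg n) (circleHeat_nonneg _))
      (mul_le_of_le_one_right (abs_nonneg n) (circleHeat_le_one (by positivity))) _

theorem exists_abs_resolventTrace_sub_le (j : ℕ) :
    ∃ C : ℝ, ∀ (n : ℕ) (z : ℝ), 0 < n → 1 ≤ z →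
      |resolventTrace (j + 1) n z - resolventDensity j z n| ≤
        C * z ^ (-2 * ((j + 1 : ℕ) : ℤ) - 2) := by
  obtain ⟨C, hC⟩ := exists_abs_discreteHeat_pow_sub_le (j + 1)
  set F : ℝ := 2 / j.factorial with hF
  have hF0 : 0 ≤ F := by positivity
  refine ⟨F * (|C| * ((j + 1).factorial / 2 + (2 * j + 2).factorial / 2)), fun n z hn hz => ?_⟩
  have : NeZero n := ⟨hn.ne'⟩
  have hz0 : 0 < z := by linarith
  have hz2 : 0 < z ^ 2 := by positivity
  obtain ⟨hi, he⟩ := resolventTrace_eq_integral j n hz0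
  rw [he, resolventDensity, ← mul_sub, ← MeasureTheory.integral_sub hi
    (integrableOn_resolventWeight_mul_circleHeat j hz0 n), abs_mul, ← hF, abs_of_nonneg hF0,
    mul_assoc]
  refine mul_le_mul_of_nonneg_left ?_ hF0
  have hg1 := integrableOn_pow_mul_exp_neg_mul_sq (2 * (j + 1) + 1) hz2
  have hg2 := integrableOn_pow_mul_exp_neg_mul_sq (2 * (2 * j + 2) + 1) hz2
  have hbound := MeasureTheory.norm_integral_le_of_norm_le ((hg1.add hg2).const_mul |C|)
    (f := fun u => resolventWeight j z u * discreteHeat n ((u * n / Real.pi) ^ 2 / 2) ^ (j + 1) -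
      resolventWeight j z u * (n * circleHeat ((u * n / Real.pi) ^ 2 / 2)) ^ (j + 1)) ?_
  · refine hbound.trans ?_
    rw [MeasureTheory.integral_const_mul, mul_assoc]
    refine mul_le_mul_of_nonneg_left ?_ (abs_nonneg C)
    simp only [Pi.add_apply]
    rw [MeasureTheory.integral_add hg1 hg2, integral_pow_odd_mul_exp_neg_mul_sq _ hz2,
      integral_pow_odd_mul_exp_neg_mul_sq _ hz2, add_mul]
    have e : z ^ (-2 * ((j + 1 : ℕ) : ℤ) - 2) = ((z ^ 2) ^ (j + 2))⁻¹ := by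
      rw [← pow_mul, ← zpow_natCast, ← zpow_neg]
      congr 1
    rw [e]
    have h12 : (1 : ℝ) ≤ z ^ 2 := one_le_pow₀ hz
    have h3 : ((z ^ 2) ^ (2 * j + 2 + 1))⁻¹ ≤ ((z ^ 2) ^ (j + 2))⁻¹ :=
      inv_anti₀ (by positivity) (pow_le_pow_right₀ h12 (by omega))
    gcongr
  · refine (MeasureTheory.ae_restrict_mem measurableSet_Ioi).mono fun u hu => ?_
    have hu0 : (0 : ℝ) < u := hu
    have hw : 0 ≤ resolventWeight j z u := by unfold resolventWeight; positivity
    rw [← mul_sub, norm_mul, Real.norm_eq_abs, Real.norm_eq_abs, abs_of_nonneg hw]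
    calc resolventWeight j z u * _ ≤
          resolventWeight j z u * (|C| * (u ^ 2 + u ^ (2 * (j + 1) + 2))) := by
          refine mul_le_mul_of_nonneg_left ((hC n u hu0).trans ?_) hw
          exact mul_le_mul_of_nonneg_right (le_abs_self C) (by positivity)
      _ = _ := by
          simp only [resolventWeight, Pi.add_apply]
          ring

/-! ### Homogeneity and smoothness -/

theorem resolventDensity_homogeneous (j : ℕ) {t : ℝ} (ht : 0 < t) (z n : ℝ) :
    resolventDensity j (t * z) (t * n) = t ^ (-((j : ℤ) + 1)) * resolventDensity j z n := by
  have h := MeasureTheory.integral_comp_mul_left_Ioi (fun u => resolventWeight j z u *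
    (n * circleHeat ((u * n / Real.pi) ^ 2 / 2)) ^ (j + 1)) 0 ht
  rw [mul_zero, smul_eq_mul] at h
  have h2 : ∀ u : ℝ, resolventWeight j (t * z) u *
      (t * n * circleHeat ((u * (t * n) / Real.pi) ^ 2 / 2)) ^ (j + 1) =
      (t ^ j)⁻¹ * (resolventWeight j z (t * u) *
        (n * circleHeat ((t * u * n / Real.pi) ^ 2 / 2)) ^ (j + 1)) := by
    intro u
    simp only [resolventWeight]
    rw [show u * (t * n) = t * u * n by ring, show u ^ 2 * (t * z) ^ 2 = (t * u) ^ 2 * z ^ 2 by ring,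
      mul_pow t u, mul_assoc t n, mul_pow t]
    field_simp
    ring
  simp only [resolventDensity]
  simp_rw [h2]
  rw [MeasureTheory.integral_const_mul, h, zpow_neg, ← Nat.cast_succ, zpow_natCast, pow_succ, mul_inv]
  ring

theorem measurable_heatDensity (j : ℕ) : Measurable fun u : ℝ => ENNReal.ofReal
    (u ^ (2 * j + 1) * circleHeat ((u / Real.pi) ^ 2 / 2) ^ (j + 1)) := by
  have := continuous_circleHeat
  have h : Continuous fun u : ℝ =>
      u ^ (2 * j + 1) * circleHeat ((u / Real.pi) ^ 2 / 2) ^ (j + 1) := by fun_prop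
  exact h.measurable.ennreal_ofReal

theorem resolventDensity_eq_mgf (j : ℕ) {z : ℝ} :
    resolventDensity j z 1 = 2 / j.factorial * ProbabilityTheory.mgf (fun u : ℝ => u ^ 2)
      ((MeasureTheory.volume.restrict (Set.Ioi 0)).withDensity fun u => ENNReal.ofReal
        (u ^ (2 * j + 1) * circleHeat ((u / Real.pi) ^ 2 / 2) ^ (j + 1))) (-z ^ 2) := by
  rw [resolventDensity, ProbabilityTheory.mgf, integral_withDensity_eq_integral_toReal_smul
    (measurable_heatDensity j) (by simp)]
  congr 1
  refine MeasureTheory.setIntegral_congr_fun measurableSet_Ioi fun u hu => ?_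
  have hu0 : (0 : ℝ) < u := hu
  have h := circleHeat_nonneg ((u / Real.pi) ^ 2 / 2)
  simp only [mul_one, one_mul, resolventWeight, smul_eq_mul]
  rw [ENNReal.toReal_ofReal (by positivity)]
  ring_nf

theorem contDiffOn_resolventDensity_one (j : ℕ) :
    ContDiffOn ℝ ∞ (fun z => resolventDensity j z 1) (Set.Ioi 0) := by
  simp_rw [resolventDensity_eq_mgf]
  refine contDiffOn_const.mul ?_
  refine (ProbabilityTheory.analyticOn_mgf.contDiffOn_of_completeSpace).comp
    (t := interior _) (by fun_prop) ?_
  have hsub : Set.Iio (0 : ℝ) ⊆ ProbabilityTheory.integrableExpSet (fun u : ℝ => u ^ 2)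
      ((MeasureTheory.volume.restrict (Set.Ioi 0)).withDensity fun u => ENNReal.ofReal
        (u ^ (2 * j + 1) * circleHeat ((u / Real.pi) ^ 2 / 2) ^ (j + 1))) := by
    intro s hs
    have hs' : 0 < -s := neg_pos.2 hs
    rw [ProbabilityTheory.integrableExpSet, Set.mem_ofPred_eq,
      MeasureTheory.integrable_withDensity_iff (measurable_heatDensity j) (by simp)]
    have h := integrableOn_resolventWeight_mul_circleHeat j (Real.sqrt_pos.2 hs') 1
    refine h.congr_fun (fun u hu => ?_) measurableSet_Ioi
    have hu0 : (0 : ℝ) < u := hu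
    have h := circleHeat_nonneg ((u / Real.pi) ^ 2 / 2)
    simp only [mul_one, one_mul, resolventWeight, Real.sq_sqrt hs'.le]
    rw [ENNReal.toReal_ofReal (by positivity)]
    ring_nf
  intro z hz
  refine interior_mono hsub ?_
  rw [interior_Iio]
  have : (0 : ℝ) < z := hz
  exact neg_lt_zero.2 (pow_pos this 2)

theorem resolventDensity_eq_zpow_mul (j : ℕ) {z n : ℝ} (hn : 0 < n) :
    resolventDensity j z n = n ^ (-((j : ℤ) + 1)) * resolventDensity j (z / n) 1 := by
  rw [← resolventDensity_homogeneous j hn, mul_one, mul_div_cancel₀ _ hn.ne']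

theorem contDiffOn_resolventDensity (j : ℕ) :
    ContDiffOn ℝ ∞ (fun p : ℝ × ℝ => resolventDensity j p.1 p.2) (Set.Ioi 0 ×ˢ Set.Ioi 0) := by
  have h1 : ContDiffOn ℝ ∞ (fun p : ℝ × ℝ => (p.2 ^ (j + 1))⁻¹ * resolventDensity j (p.1 / p.2) 1)
      (Set.Ioi 0 ×ˢ Set.Ioi 0) := by
    have hne : ∀ p ∈ Set.Ioi (0 : ℝ) ×ˢ Set.Ioi (0 : ℝ), p.2 ≠ 0 := fun p hp => (hp.2 : 0 < p.2).ne'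
    refine ContDiffOn.mul ?_ ?_
    · exact ContDiffOn.inv (by fun_prop) fun p hp => pow_ne_zero _ (hne p hp)
    · refine (contDiffOn_resolventDensity_one j).comp
        (contDiffOn_fst.div contDiffOn_snd hne) fun p hp => ?_
      exact div_pos (Set.mem_Ioi.1 hp.1) (Set.mem_Ioi.1 hp.2)
  refine h1.congr fun p hp => ?_
  rw [resolventDensity_eq_zpow_mul j hp.2, zpow_neg, ← Nat.cast_succ, zpow_natCast]

/-! ### Asymptotic power series at `0⁺` -/

/-- `f` agrees with a polynomial up to `O(s ^ K)` as `s → 0⁺`. -/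
def HasPowerExpansion (K : ℕ) (f : ℝ → ℝ) : Prop :=
  ∃ p : Polynomial ℝ, (fun s => f s - p.eval s) =O[nhdsWithin 0 (Set.Ioi 0)] fun s => s ^ K

/-- `f s` agrees with `p s + q s * log s`, for polynomials `p` and `q`, up to `O(s ^ K)` as
`s → 0⁺`. -/
def HasLogExpansion (K : ℕ) (f : ℝ → ℝ) : Prop :=
  ∃ p q : Polynomial ℝ, (fun s => f s - (p.eval s + q.eval s * Real.log s))
    =O[nhdsWithin 0 (Set.Ioi 0)] fun s => s ^ K

theorem Polynomial.isBigO_eval_one (p : Polynomial ℝ) :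
    (fun s => p.eval s) =O[nhdsWithin 0 (Set.Ioi 0)] fun _ => (1 : ℝ) :=
  ((p.continuous.tendsto 0).mono_left nhdsWithin_le_nhds).isBigO_one ℝ

theorem isBigO_pow_one (K : ℕ) :
    (fun s : ℝ => s ^ K) =O[nhdsWithin 0 (Set.Ioi 0)] fun _ => (1 : ℝ) := by
  simpa using Polynomial.isBigO_eval_one (Polynomial.X ^ K)

namespace HasPowerExpansion

variable {K : ℕ} {f g : ℝ → ℝ}

theorem congr' (h : HasPowerExpansion K f) (hfg : ∀ s : ℝ, 0 < s → f s = g s) :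
    HasPowerExpansion K g := by
  obtain ⟨p, hp⟩ := h
  refine ⟨p, hp.congr' ?_ EventuallyEq.rfl⟩
  filter_upwards [self_mem_nhdsWithin] with s hs
  rw [hfg s hs]

theorem eval (p : Polynomial ℝ) : HasPowerExpansion K fun s => p.eval s :=
  ⟨p, by simpa using isBigO_zero _ _⟩

theorem of_isBigO (h : f =O[nhdsWithin 0 (Set.Ioi 0)] fun s => s ^ K) : HasPowerExpansion K f :=
  ⟨0, by simpa using h⟩

theorem isBigO_one (h : HasPowerExpansion K f) :
    f =O[nhdsWithin 0 (Set.Ioi 0)] fun _ => (1 : ℝ) := by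
  obtain ⟨p, hp⟩ := h
  simpa using (hp.trans (isBigO_pow_one K)).add p.isBigO_eval_one

theorem add (hf : HasPowerExpansion K f) (hg : HasPowerExpansion K g) :
    HasPowerExpansion K fun s => f s + g s := by
  obtain ⟨p, hp⟩ := hf
  obtain ⟨q, hq⟩ := hg
  refine ⟨p + q, (hp.add hq).congr_left fun s => ?_⟩
  rw [Polynomial.eval_add]
  ring

theorem mul (hf : HasPowerExpansion K f) (hg : HasPowerExpansion K g) :
    HasPowerExpansion K fun s => f s * g s := by
  have hg1 := hg.isBigO_one
  obtain ⟨p, hp⟩ := hf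
  obtain ⟨q, hq⟩ := hg
  have h1 := hp.mul hg1
  have h2 := p.isBigO_eval_one.mul hq
  simp only [mul_one, one_mul] at h1 h2
  refine ⟨p * q, (h1.add h2).congr_left fun s => ?_⟩
  rw [Polynomial.eval_mul]
  ring

theorem pow (hf : HasPowerExpansion K f) (k : ℕ) : HasPowerExpansion K fun s => f s ^ k := by
  induction k with
  | zero => simpa using eval (K := K) 1
  | succ k ih => simpa only [pow_succ] using ih.mul hf

theorem comp_mul_left (hf : HasPowerExpansion K f) {c : ℝ} (hc : 0 < c) :
    HasPowerExpansion K fun s => f (c * s) := by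
  obtain ⟨p, hp⟩ := hf
  have ht : Tendsto (fun s : ℝ => c * s) (nhdsWithin 0 (Set.Ioi 0)) (nhdsWithin 0 (Set.Ioi 0)) := by
    refine tendsto_nhdsWithin_iff.2 ⟨?_, ?_⟩
    · have : Tendsto (fun s : ℝ => c * s) (nhds 0) (nhds (c * 0)) :=
        (continuous_const.mul continuous_id).tendsto 0
      rw [mul_zero] at this
      exact this.mono_left nhdsWithin_le_nhds
    · filter_upwards [self_mem_nhdsWithin] with s hs
      exact mul_pos hc hs
  refine ⟨p.comp (Polynomial.C c * Polynomial.X), ?_⟩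
  have h1 : ((fun s : ℝ => s ^ K) ∘ fun s => c * s) =O[nhdsWithin 0 (Set.Ioi 0)]
      fun s => s ^ K := by
    refine IsBigO.of_bound (c ^ K) (Eventually.of_forall fun s => ?_)
    simp only [Function.comp_apply, mul_pow, norm_mul, norm_pow, Real.norm_eq_abs, abs_of_pos hc]
    exact le_rfl
  refine ((hp.comp_tendsto ht).trans h1).congr_left fun s => ?_
  simp [Polynomial.eval_comp]

theorem of_analyticAt (hf : AnalyticAt ℝ f 0) (K : ℕ) : HasPowerExpansion K f := by
  obtain ⟨P, hP⟩ := hf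
  have h := (hP.isBigO_sub_partialSum_pow K).mono (nhdsWithin_le_nhds (s := Set.Ioi 0))
  refine ⟨∑ k ∈ Finset.range K, Polynomial.C (P.coeff k) * Polynomial.X ^ k, ?_⟩
  have h1 : (fun y : ℝ => ‖y‖ ^ K) =O[nhdsWithin 0 (Set.Ioi 0)] fun s => s ^ K :=
    IsBigO.of_bound 1 (Eventually.of_forall fun s => by simp)
  refine (h.trans h1).congr_left fun s => ?_
  rw [zero_add, FormalMultilinearSeries.partialSum, Polynomial.eval_finsetSum]
  congr 1
  refine Finset.sum_congr rfl fun k _ => ?_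
  rw [FormalMultilinearSeries.apply_eq_pow_smul_coeff, smul_eq_mul, Polynomial.eval_mul,
    Polynomial.eval_C, Polynomial.eval_pow, Polynomial.eval_X, mul_comm]

/-- Two-sided control on the whole half-line, for bounded functions. -/
theorem exists_global (hf : HasPowerExpansion K f) {C : ℝ} (hC : ∀ u, 0 < u → |f u| ≤ C) :
    ∃ p : Polynomial ℝ, p.natDegree ≤ K ∧ ∃ c : ℝ, 0 ≤ c ∧
      ∀ u, 0 < u → |f u - p.eval u| ≤ c * u ^ K := by
  obtain ⟨p, hp⟩ := hf
  have hmonic : (Polynomial.X ^ K : Polynomial ℝ).Monic := Polynomial.monic_X_pow K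
  set r := p %ₘ (Polynomial.X ^ K) with hr
  have hrK : r.natDegree ≤ K := by
    have := Polynomial.natDegree_modByMonic_le p hmonic
    rwa [Polynomial.natDegree_X_pow] at this
  have hpr : ∀ u, p.eval u = r.eval u + u ^ K * (p /ₘ (Polynomial.X ^ K)).eval u := by
    intro u
    conv_lhs => rw [← Polynomial.modByMonic_add_div p (Polynomial.X ^ K)]
    simp [hr]
  have h1 : (fun s => f s - r.eval s) =O[nhdsWithin 0 (Set.Ioi 0)] fun s => s ^ K := by
    have h2 := (isBigO_refl (fun s : ℝ => s ^ K) (nhdsWithin 0 (Set.Ioi 0))).mul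
      (p /ₘ (Polynomial.X ^ K)).isBigO_eval_one
    simp only [mul_one] at h2
    refine (hp.add h2).congr_left fun s => ?_
    rw [hpr]
    ring
  obtain ⟨c, hc0, hc⟩ := h1.exists_nonneg
  obtain ⟨δ, hδ, hδs⟩ := mem_nhdsGT_iff_exists_Ioo_subset.1 hc.bound
  have hδ0 : (0 : ℝ) < δ := hδ
  set A := ∑ i ∈ Finset.range (K + 1), |r.coeff i| / δ ^ (K - i)
  have hA : 0 ≤ A := Finset.sum_nonneg fun i _ => by positivity
  have hC0 : 0 ≤ C := (abs_nonneg _).trans (hC 1 one_pos)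
  refine ⟨r, hrK, c + (C / δ ^ K + A), by positivity, fun u hu => ?_⟩
  have huK : 0 < u ^ K := pow_pos hu K
  rcases lt_or_ge u δ with h | h
  · have := hδs ⟨hu, h⟩
    simp only [Set.mem_ofPred_eq, Real.norm_eq_abs, abs_of_pos huK] at this
    refine this.trans ?_
    have : 0 ≤ (C / δ ^ K + A) * u ^ K := by positivity
    linarith
  · have hpow : ∀ i ≤ K, u ^ i ≤ u ^ K / δ ^ (K - i) := by
      intro i hi
      rw [le_div_iff₀ (by positivity)]
      calc u ^ i * δ ^ (K - i) ≤ u ^ i * u ^ (K - i) := by gcongr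
        _ = u ^ K := by rw [← pow_add, Nat.add_sub_cancel' hi]
    have h2 : |r.eval u| ≤ A * u ^ K := by
      rw [Polynomial.eval_eq_sum_range' (Nat.lt_succ_of_le hrK), Finset.sum_mul]
      refine (Finset.abs_sum_le_sum_abs _ _).trans (Finset.sum_le_sum fun i hi => ?_)
      rw [abs_mul, abs_of_pos (pow_pos hu i), div_mul_eq_mul_div, mul_div_assoc]
      exact mul_le_mul_of_nonneg_left (hpow i (Nat.le_of_lt_succ (Finset.mem_range.1 hi)))
        (abs_nonneg _)
    have h3 : C ≤ C / δ ^ K * u ^ K := by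
      have := mul_le_mul_of_nonneg_left (hpow 0 (Nat.zero_le _)) hC0
      rw [pow_zero, mul_one, Nat.sub_zero] at this
      rwa [div_mul_eq_mul_div, mul_div_assoc]
    have h4 := abs_sub (f u) (r.eval u)
    have h5 : 0 ≤ c * u ^ K := by positivity
    linarith [hC u hu]

end HasPowerExpansion

/-- A scaling superposition `s ↦ ∫ w φ(s V)` inherits the expansion of `φ` to the order to which
the moments `∫ w V ^ k` exist. -/
theorem exists_polynomial_integral_scaling {α : Type*} [MeasurableSpace α]
    {μ : MeasureTheory.Measure α} {w V : α → ℝ} {φ : ℝ → ℝ} {K : ℕ} {p : Polynomial ℝ} {c : ℝ}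
    (hw : ∀ k ≤ K, MeasureTheory.Integrable (fun x => w x * V x ^ k) μ)
    (hV : ∀ᵐ x ∂μ, 0 < V x) (hVm : Measurable V) (hφ : Measurable φ) (hp : p.natDegree ≤ K)
    (hc : ∀ u, 0 < u → |φ u - p.eval u| ≤ c * u ^ K) :
    ∃ (P : Polynomial ℝ) (c' : ℝ), ∀ s, 0 < s →
      |(∫ x, w x * φ (s * V x) ∂μ) - P.eval s| ≤ c' * s ^ K := by
  have hw0 : MeasureTheory.AEStronglyMeasurable w μ := by
    simpa using (hw 0 (Nat.zero_le _)).aestronglyMeasurable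
  have hpe : ∀ s x, w x * p.eval (s * V x) =
      ∑ i ∈ Finset.range (K + 1), p.coeff i * s ^ i * (w x * V x ^ i) := by
    intro s x
    rw [Polynomial.eval_eq_sum_range' (Nat.lt_succ_of_le hp), Finset.mul_sum]
    refine Finset.sum_congr rfl fun i _ => ?_
    rw [mul_pow]
    ring
  have hpi : ∀ s, MeasureTheory.Integrable (fun x => w x * p.eval (s * V x)) μ := by
    intro s
    simp_rw [hpe]
    exact MeasureTheory.integrable_finsetSum _ fun i hi =>
      (hw i (Nat.le_of_lt_succ (Finset.mem_range.1 hi))).const_mul _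
  have hbound : ∀ s, 0 < s → ∀ᵐ x ∂μ, ‖w x * (φ (s * V x) - p.eval (s * V x))‖ ≤
      c * s ^ K * ‖w x * V x ^ K‖ := by
    intro s hs
    filter_upwards [hV] with x hx
    rw [norm_mul, norm_mul, Real.norm_eq_abs (φ _ - _), norm_pow, Real.norm_eq_abs (V x),
      abs_of_pos hx]
    have := mul_le_mul_of_nonneg_left (hc (s * V x) (mul_pos hs hx)) (norm_nonneg (w x))
    rw [mul_pow] at this
    linarith
  have hdi : ∀ s, 0 < s →
      MeasureTheory.Integrable (fun x => w x * (φ (s * V x) - p.eval (s * V x))) μ := by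
    intro s hs
    refine ((hw K le_rfl).norm.const_mul (c * s ^ K)).mono' ?_ (hbound s hs)
    have := p.continuous.measurable
    exact hw0.mul (Measurable.aestronglyMeasurable (by fun_prop))
  refine ⟨∑ i ∈ Finset.range (K + 1),
    Polynomial.C (p.coeff i * ∫ x, w x * V x ^ i ∂μ) * Polynomial.X ^ i,
    c * ∫ x, ‖w x * V x ^ K‖ ∂μ, fun s hs => ?_⟩
  have h1 : (∑ i ∈ Finset.range (K + 1),
      Polynomial.C (p.coeff i * ∫ x, w x * V x ^ i ∂μ) * Polynomial.X ^ i).eval s =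
      ∫ x, w x * p.eval (s * V x) ∂μ := by
    simp_rw [hpe]
    rw [MeasureTheory.integral_finsetSum _ fun i hi =>
      (hw i (Nat.le_of_lt_succ (Finset.mem_range.1 hi))).const_mul _, Polynomial.eval_finsetSum]
    refine Finset.sum_congr rfl fun i _ => ?_
    rw [MeasureTheory.integral_const_mul]
    simp only [Polynomial.eval_mul, Polynomial.eval_C, Polynomial.eval_pow, Polynomial.eval_X]
    ring
  have h2 : ∫ x, w x * φ (s * V x) ∂μ = (∫ x, w x * (φ (s * V x) - p.eval (s * V x)) ∂μ) +
      ∫ x, w x * p.eval (s * V x) ∂μ := by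
    rw [← MeasureTheory.integral_add (hdi s hs) (hpi s)]
    simp_rw [mul_sub, sub_add_cancel]
  rw [h1, h2, add_sub_cancel_right, mul_right_comm, ← MeasureTheory.integral_const_mul]
  exact MeasureTheory.norm_integral_le_of_norm_le ((hw K le_rfl).norm.const_mul _) (hbound s hs)

theorem HasPowerExpansion.of_abs_sub_le {K : ℕ} {f : ℝ → ℝ} {P : Polynomial ℝ} {c : ℝ}
    (h : ∀ s, 0 < s → |f s - P.eval s| ≤ c * s ^ K) : HasPowerExpansion K f := by
  refine ⟨P, IsBigO.of_bound c ?_⟩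
  filter_upwards [self_mem_nhdsWithin] with s hs
  rw [Real.norm_eq_abs, Real.norm_eq_abs, abs_of_pos (pow_pos (Set.mem_Ioi.1 hs) K : 0 < s ^ K)]
  exact h s hs

theorem HasPowerExpansion.integral_scaling {α : Type*} [MeasurableSpace α]
    {μ : MeasureTheory.Measure α} {w V : α → ℝ} {φ : ℝ → ℝ} {K : ℕ} {C : ℝ}
    (hf : HasPowerExpansion K φ) (hC : ∀ u, 0 < u → |φ u| ≤ C) (hφ : Measurable φ)
    (hw : ∀ k ≤ K, MeasureTheory.Integrable (fun x => w x * V x ^ k) μ)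
    (hV : ∀ᵐ x ∂μ, 0 < V x) (hVm : Measurable V) :
    HasPowerExpansion K fun s => ∫ x, w x * φ (s * V x) ∂μ := by
  obtain ⟨p, hp, c, -, hc⟩ := hf.exists_global hC
  obtain ⟨P, c', h⟩ := exists_polynomial_integral_scaling hw hV hVm hφ hp hc
  exact of_abs_sub_le h

namespace HasLogExpansion

variable {K : ℕ} {f g : ℝ → ℝ}

theorem of_hasPowerExpansion (h : HasPowerExpansion K f) : HasLogExpansion K f := by
  obtain ⟨p, hp⟩ := h
  exact ⟨p, 0, by simpa using hp⟩

theorem congr' (h : HasLogExpansion K f)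
    (hfg : ∀ᶠ s in nhdsWithin (0 : ℝ) (Set.Ioi 0), f s = g s) : HasLogExpansion K g := by
  obtain ⟨p, q, hp⟩ := h
  refine ⟨p, q, hp.congr' ?_ EventuallyEq.rfl⟩
  filter_upwards [hfg] with s hs
  rw [hs]

theorem eval_mul_log (q : Polynomial ℝ) : HasLogExpansion K fun s => q.eval s * Real.log s :=
  ⟨0, q, by simpa using isBigO_zero _ _⟩

theorem add (hf : HasLogExpansion K f) (hg : HasLogExpansion K g) :
    HasLogExpansion K fun s => f s + g s := by
  obtain ⟨p, q, hp⟩ := hf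
  obtain ⟨p', q', hq⟩ := hg
  refine ⟨p + p', q + q', (hp.add hq).congr_left fun s => ?_⟩
  rw [Polynomial.eval_add, Polynomial.eval_add]
  ring

theorem const_mul (hf : HasLogExpansion K f) (c : ℝ) : HasLogExpansion K fun s => c * f s := by
  obtain ⟨p, q, hp⟩ := hf
  refine ⟨Polynomial.C c * p, Polynomial.C c * q, (hp.const_mul_left c).congr_left fun s => ?_⟩
  simp only [Polynomial.eval_mul, Polynomial.eval_C]
  ring

theorem sum {ι : Type*} (S : Finset ι) {F : ι → ℝ → ℝ} (h : ∀ i ∈ S, HasLogExpansion K (F i)) :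
    HasLogExpansion K fun s => ∑ i ∈ S, F i s := by
  classical
  induction S using Finset.induction_on with
  | empty => simpa using of_hasPowerExpansion (HasPowerExpansion.eval (K := K) 0)
  | insert i S hi ih =>
    simp_rw [Finset.sum_insert hi]
    exact (h i (Finset.mem_insert_self i S)).add
      (ih fun j hj => h j (Finset.mem_insert_of_mem hj))

end HasLogExpansion

theorem HasLogExpansion.exists_isLittleO_atTop {f : ℝ → ℝ} {K : ℕ} (hK : 1 ≤ K)
    (h : HasLogExpansion K fun s => f s⁻¹) :
    ∃ a b : ℕ → ℝ, (fun x => f x - ∑ j ∈ Finset.range K, (a j + b j * Real.log x) * (x ^ j)⁻¹)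
      =o[atTop] fun x => (x ^ K)⁻¹ * Real.log x ^ 2 := by
  obtain ⟨p, q, hpq⟩ := h
  have hmonic : (Polynomial.X ^ K : Polynomial ℝ).Monic := Polynomial.monic_X_pow K
  have hne : (Polynomial.X ^ K : Polynomial ℝ) ≠ 1 := by
    intro h
    have := congrArg Polynomial.natDegree h
    rw [Polynomial.natDegree_X_pow, Polynomial.natDegree_one] at this
    omega
  have hdeg : ∀ p : Polynomial ℝ, (p %ₘ Polynomial.X ^ K).natDegree < K := fun p => by
    simpa using Polynomial.natDegree_modByMonic_lt p hmonic hne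
  have hsplit : ∀ (p : Polynomial ℝ) (u : ℝ), p.eval u =
      ∑ i ∈ Finset.range K, (p %ₘ Polynomial.X ^ K).coeff i * u ^ i +
        u ^ K * (p /ₘ (Polynomial.X ^ K)).eval u := by
    intro p u
    rw [← Polynomial.eval_eq_sum_range' (hdeg p)]
    conv_lhs => rw [← Polynomial.modByMonic_add_div p (Polynomial.X ^ K)]
    simp
  have ht := tendsto_inv_atTop_nhdsGT_zero (𝕜 := ℝ)
  have hlog : (fun _ : ℝ => (1 : ℝ)) =o[atTop] Real.log :=
    Real.isLittleO_const_log_atTop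
  have h1log : (fun _ : ℝ => (1 : ℝ)) =o[atTop] fun x => Real.log x ^ 2 := by
    simpa [sq] using hlog.mul hlog
  have hlog2 : Real.log =o[atTop] fun x => Real.log x ^ 2 := by
    simpa [sq] using hlog.mul_isBigO (isBigO_refl Real.log atTop)
  have hpK : (fun x : ℝ => x⁻¹ ^ K) =O[atTop] fun x => (x ^ K)⁻¹ := by
    simp_rw [inv_pow]
    exact isBigO_refl _ _
  have e1 := ((hpq.comp_tendsto ht).trans hpK).mul_isLittleO h1log
  have e2 := (hpK.mul ((p /ₘ (Polynomial.X ^ K)).isBigO_eval_one.comp_tendsto ht)).mul_isLittleO h1log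
  have e3 := (hpK.mul ((q /ₘ (Polynomial.X ^ K)).isBigO_eval_one.comp_tendsto ht)).mul_isLittleO hlog2
  simp only [Function.comp_def, mul_one, inv_inv, Real.log_inv] at e1 e2 e3
  refine ⟨fun j => (p %ₘ Polynomial.X ^ K).coeff j, fun j => -(q %ₘ Polynomial.X ^ K).coeff j,
    ((e1.add e2).sub e3).congr_left fun x => ?_⟩
  rw [hsplit p, hsplit q]
  simp_rw [add_mul, Finset.sum_add_distrib, neg_mul, inv_pow, Finset.sum_neg_distrib]
  have e4 : ∑ i ∈ Finset.range K, (q %ₘ Polynomial.X ^ K).coeff i * Real.log x * (x ^ i)⁻¹ =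
      (∑ i ∈ Finset.range K, (q %ₘ Polynomial.X ^ K).coeff i * (x ^ i)⁻¹) * Real.log x := by
    rw [Finset.sum_mul]
    exact Finset.sum_congr rfl fun i _ => by ring
  rw [e4]
  ring

theorem hasLogPolyhomogeneousExpansion_of_hasLogExpansion {f : ℝ → ℝ}
    (h : ∀ K, HasLogExpansion K fun s => f s⁻¹) :
    HasLogPolyhomogeneousExpansion fun x => (f x : ℂ) := by
  intro r hr
  obtain ⟨K, hK⟩ := exists_nat_gt r
  have hK1 : 1 ≤ K := by
    rcases Nat.eq_zero_or_pos K with rfl | hpos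
    · simp only [Nat.cast_zero] at hK
      linarith
    · exact hpos
  obtain ⟨a, b, hab⟩ := (h K).exists_isLittleO_atTop hK1
  refine ⟨K, fun j => -(j : ℂ), fun j => if j = K then 2 else 1,
    fun j k => if k = 0 then (a j : ℂ) else (b j : ℂ), hK1, ?_, ?_, ?_⟩
  · intro i j _ hij _
    simp only [Complex.neg_re, Complex.natCast_re, neg_le_neg_iff, Nat.cast_le]
    exact hij
  · simp only [Complex.neg_re, Complex.natCast_re]
    linarith
  · rw [← isLittleO_norm_norm] at hab ⊢
    refine hab.congr' ?_ ?_
    · filter_upwards [eventually_gt_atTop 0] with x hx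
      rw [← Complex.norm_real]
      congr 1
      have hterm : ∀ j < K, ∑ k ∈ Finset.range ((if j = K then 2 else 1) + 1),
          (if k = 0 then (a j : ℂ) else (b j : ℂ)) * (x : ℂ) ^ (-(j : ℂ)) *
            (Real.log x : ℂ) ^ k =
          (((a j + b j * Real.log x) * (x ^ j)⁻¹ : ℝ) : ℂ) := by
        intro j hj
        rw [if_neg hj.ne, Finset.sum_range_succ, Finset.sum_range_one, if_pos rfl,
          if_neg one_ne_zero, Complex.cpow_neg, Complex.cpow_natCast]
        push_cast
        ring
      have hzero : ∑ k ∈ Finset.range ((if 0 = K then 2 else 1) + 1),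
          (if k = 0 then (a 0 : ℂ) else (b 0 : ℂ)) * (Real.log x : ℂ) ^ k =
          (((a 0 + b 0 * Real.log x) * (x ^ 0)⁻¹ : ℝ) : ℂ) := by
        rw [← hterm 0 hK1]
        simp
      rw [hzero, Finset.sum_congr rfl fun j hj => hterm j (Finset.mem_Ico.1 hj).2,
        Finset.range_eq_Ico, Finset.sum_eq_sum_Ico_succ_bot hK1]
      push_cast
      ring
    · filter_upwards [eventually_gt_atTop 0] with x hx
      rw [if_pos rfl, Complex.cpow_neg, Complex.cpow_natCast, ← Complex.norm_real]
      push_cast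
      rfl

/-! ### Expansions of the heat kernel on the diagonal -/

theorem hasPowerExpansion_exp_neg_sq (K : ℕ) :
    HasPowerExpansion K fun u => Real.exp (-u ^ 2) :=
  HasPowerExpansion.of_analyticAt (by fun_prop) K

theorem abs_exp_neg_sq_le_one (u : ℝ) : |Real.exp (-u ^ 2)| ≤ 1 := by
  rw [abs_of_pos (Real.exp_pos _), Real.exp_le_one_iff, neg_nonpos]
  positivity

theorem one_sub_cos_eq (x : ℝ) : 1 - Real.cos x = 2 * Real.sin (x / 2) ^ 2 := by
  rw [Real.sin_sq_eq_half_sub]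
  ring_nf

/-- Small-time expansion. -/
theorem hasPowerExpansion_circleHeat (K : ℕ) :
    HasPowerExpansion K fun u => circleHeat ((u / Real.pi) ^ 2 / 2) := by
  have h1 : HasPowerExpansion K fun s => ∫ x, (2 * Real.pi)⁻¹ *
      (fun u => Real.exp (-u ^ 2)) (s * Real.sin (x / 2))
        ∂MeasureTheory.volume.restrict (Set.Ioo 0 (2 * Real.pi)) := by
    refine HasPowerExpansion.integral_scaling (w := fun _ => (2 * Real.pi)⁻¹)
      (hasPowerExpansion_exp_neg_sq K) (fun u _ => abs_exp_neg_sq_le_one u)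
      (by fun_prop) (fun k _ => ?_) ?_ (by fun_prop)
    · exact (Continuous.integrableOn_Icc (by fun_prop)).mono_set Set.Ioo_subset_Icc_self
    · filter_upwards [MeasureTheory.ae_restrict_mem measurableSet_Ioo] with x hx
      exact Real.sin_pos_of_pos_of_lt_pi (by linarith [hx.1]) (by linarith [hx.2])
  have h2 := h1.comp_mul_left (inv_pos.2 Real.pi_pos)
  refine h2.congr' fun s _ => ?_
  rw [circleHeat, intervalIntegral.integral_of_le (by positivity),
    MeasureTheory.integral_Ioc_eq_integral_Ioo, MeasureTheory.integral_const_mul]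
  congr 2
  funext x
  rw [one_sub_cos_eq]
  beta_reduce
  congr 1
  ring

theorem circleHeat_sq_div_two (v : ℝ) : circleHeat (v ^ 2 / 2) =
    2 / Real.pi * ((∫ θ in (0 : ℝ)..(Real.pi / 4), Real.exp (-(v * Real.sin θ) ^ 2)) +
      ∫ θ in (Real.pi / 4)..(Real.pi / 2), Real.exp (-(v * Real.sin θ) ^ 2)) := by
  set F : ℝ → ℝ := fun θ => Real.exp (-(v * Real.sin θ) ^ 2) with hF
  have hi : ∀ a b, IntervalIntegrable F MeasureTheory.volume a b := fun a b =>
    Continuous.intervalIntegrable (by fun_prop) a b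
  have h1 : ∫ x in (0 : ℝ)..(2 * Real.pi), Real.exp (-(v ^ 2 / 2 * (1 - Real.cos x))) =
      2 * ∫ θ in (0 : ℝ)..Real.pi, F θ := by
    have h := intervalIntegral.integral_comp_div (a := 0) (b := 2 * Real.pi) F
      (two_ne_zero : (2 : ℝ) ≠ 0)
    rw [zero_div, mul_div_cancel_left₀ _ (two_ne_zero : (2 : ℝ) ≠ 0), smul_eq_mul] at h
    rw [← h]
    refine intervalIntegral.integral_congr fun x _ => ?_
    simp only [hF]
    rw [one_sub_cos_eq]
    congr 1
    ring
  have h2 : ∫ θ in (Real.pi / 2)..Real.pi, F θ = ∫ θ in (0 : ℝ)..(Real.pi / 2), F θ := by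
    have h := intervalIntegral.integral_comp_sub_left (a := 0) (b := Real.pi / 2) F Real.pi
    rw [sub_zero, sub_half] at h
    rw [← h]
    refine intervalIntegral.integral_congr fun x _ => ?_
    simp only [hF, Real.sin_pi_sub]
  rw [intervalIntegral.integral_add_adjacent_intervals (hi _ _) (hi _ _), circleHeat, h1,
    ← intervalIntegral.integral_add_adjacent_intervals (hi 0 (Real.pi / 2)) (hi _ Real.pi), h2]
  field_simp
  ring

/-- The Jacobian of `w = sin θ` on `[0, π/4]`, extended by zero. -/
noncomputable def arcsinJacobian (w : ℝ) : ℝ :=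
  (Set.Iic (Real.sin (Real.pi / 4))).indicator (fun w => 1 / Real.sqrt (1 - w ^ 2)) w

theorem sin_pi_div_four_pos : 0 < Real.sin (Real.pi / 4) := by
  rw [Real.sin_pi_div_four]
  positivity

theorem sq_le_half_of_le_sin_pi_div_four {w : ℝ} (h0 : 0 ≤ w) (h : w ≤ Real.sin (Real.pi / 4)) :
    w ^ 2 ≤ 1 / 2 := by
  have h1 : w ^ 2 ≤ Real.sin (Real.pi / 4) ^ 2 := by gcongr
  rw [Real.sin_pi_div_four, div_pow, Real.sq_sqrt (by norm_num)] at h1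
  linarith

theorem measurable_arcsinJacobian : Measurable arcsinJacobian :=
  Measurable.indicator (by fun_prop) measurableSet_Iic

theorem abs_arcsinJacobian_le {w : ℝ} (hw : 0 < w) : |arcsinJacobian w| ≤ 2 := by
  unfold arcsinJacobian
  rcases le_or_gt w (Real.sin (Real.pi / 4)) with h | h
  · rw [Set.indicator_of_mem (Set.mem_Iic.2 h), abs_of_nonneg (by positivity)]
    have h1 := sq_le_half_of_le_sin_pi_div_four hw.le h
    have h2 : (1 / 2 : ℝ) ≤ Real.sqrt (1 - w ^ 2) :=
      Real.le_sqrt_of_sq_le (by linarith)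
    rw [div_le_iff₀ (by linarith)]
    linarith
  · rw [Set.indicator_of_notMem (by simpa using h)]
    norm_num

theorem hasPowerExpansion_arcsinJacobian (K : ℕ) : HasPowerExpansion K arcsinJacobian := by
  have h1 : AnalyticAt ℝ (fun w : ℝ => 1 / Real.sqrt (1 - w ^ 2)) 0 := by
    rw [← analyticWithinAt_univ, ← contDiffWithinAt_omega_iff_analyticWithinAt]
    refine contDiffAt_const.div (ContDiffAt.sqrt (by fun_prop) (by norm_num)) (by norm_num)
  obtain ⟨p, hp⟩ := HasPowerExpansion.of_analyticAt h1 K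
  refine ⟨p, hp.congr' ?_ EventuallyEq.rfl⟩
  filter_upwards [nhdsWithin_le_nhds (Iic_mem_nhds sin_pi_div_four_pos)] with w hw
  rw [arcsinJacobian, Set.indicator_of_mem hw]

theorem integral_exp_neg_mul_sin_sq (v : ℝ) :
    ∫ θ in (0 : ℝ)..(Real.pi / 4), Real.exp (-(v * Real.sin θ) ^ 2) =
      ∫ w in Set.Ioi (0 : ℝ), Real.exp (-(v * w) ^ 2) * arcsinJacobian w := by
  have hb := sin_pi_div_four_pos
  have hsub : ∀ w ∈ Set.uIcc 0 (Real.sin (Real.pi / 4)), w ^ 2 ≤ 1 / 2 := by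
    intro w hw
    rw [Set.uIcc_of_le hb.le] at hw
    exact sq_le_half_of_le_sin_pi_div_four hw.1 hw.2
  have h := intervalIntegral.integral_comp_mul_deriv' (a := 0) (b := Real.sin (Real.pi / 4))
    (f := Real.arcsin) (f' := fun w => 1 / Real.sqrt (1 - w ^ 2))
    (g := fun θ => Real.exp (-(v * Real.sin θ) ^ 2))
    (fun w hw => Real.hasDerivAt_arcsin
      (by rintro rfl; have := hsub _ hw; norm_num at this)
      (by rintro rfl; have := hsub _ hw; norm_num at this))
    (ContinuousOn.div (by fun_prop) (by fun_prop) fun w hw =>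
      (Real.sqrt_pos.2 (by linarith [hsub w hw])).ne')
    (Continuous.continuousOn (by fun_prop))
  rw [Real.arcsin_zero, Real.arcsin_sin (by linarith [Real.pi_pos]) (by linarith [Real.pi_pos])] at h
  rw [← h, intervalIntegral.integral_of_le hb.le]
  have h2 : ∀ w, Real.exp (-(v * w) ^ 2) * arcsinJacobian w =
      (Set.Iic (Real.sin (Real.pi / 4))).indicator
        (fun w => Real.exp (-(v * w) ^ 2) * (1 / Real.sqrt (1 - w ^ 2))) w := by
    intro w
    rw [arcsinJacobian, Set.indicator_mul_right]
  simp_rw [h2]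
  rw [MeasureTheory.setIntegral_indicator measurableSet_Iic, Set.Ioi_inter_Iic]
  refine MeasureTheory.setIntegral_congr_fun measurableSet_Ioc fun w hw => ?_
  have h3 := sq_le_half_of_le_sin_pi_div_four hw.1.le hw.2
  simp only [Function.comp_apply]
  rw [Real.sin_arcsin (by nlinarith [hw.1]) (by nlinarith [hw.1])]

theorem integrableOn_pow_mul_exp_neg_sq (k : ℕ) :
    MeasureTheory.IntegrableOn (fun u : ℝ => u ^ k * Real.exp (-u ^ 2)) (Set.Ioi 0) := by
  simpa using integrableOn_pow_mul_exp_neg_mul_sq k one_pos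

/-- Large-time expansion (Laplace's method). -/
theorem hasPowerExpansion_inv_mul_circleHeat (K : ℕ) :
    HasPowerExpansion K fun s => s⁻¹ * circleHeat (s⁻¹ ^ 2 / 2) := by
  have h1 : HasPowerExpansion K fun s => ∫ r in Set.Ioi (0 : ℝ),
      Real.exp (-r ^ 2) * arcsinJacobian (s * r) := by
    refine HasPowerExpansion.integral_scaling (w := fun r => Real.exp (-r ^ 2)) (V := fun r => r)
      (hasPowerExpansion_arcsinJacobian K) (fun u hu => abs_arcsinJacobian_le hu)
      measurable_arcsinJacobian (fun k _ => ?_)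
      (MeasureTheory.ae_restrict_mem measurableSet_Ioi) measurable_id
    refine (integrableOn_pow_mul_exp_neg_sq k).congr_fun (fun u _ => ?_) measurableSet_Ioi
    exact mul_comm _ _
  have h2 : HasPowerExpansion K fun s => s⁻¹ *
      ∫ θ in (Real.pi / 4)..(Real.pi / 2), Real.exp (-(s⁻¹ * Real.sin θ) ^ 2) := by
    refine HasPowerExpansion.of_isBigO
      (IsBigO.of_bound ((K + 1).factorial * 2 ^ (K + 1) * (Real.pi / 4)) ?_)
    filter_upwards [Ioo_mem_nhdsGT (zero_lt_one : (0 : ℝ) < 1)] with s hs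
    have hs0 := hs.1
    have hb : ∀ θ ∈ Set.uIoc (Real.pi / 4) (Real.pi / 2),
        ‖Real.exp (-(s⁻¹ * Real.sin θ) ^ 2)‖ ≤
          (K + 1).factorial * 2 ^ (K + 1) * s ^ (2 * (K + 1)) := by
      intro θ hθ
      rw [Set.uIoc_of_le (by linarith [Real.pi_pos])] at hθ
      have hsin : Real.sin (Real.pi / 4) ≤ Real.sin θ :=
        Real.sin_le_sin_of_le_of_le_pi_div_two (by linarith [Real.pi_pos]) hθ.2 hθ.1.le
      have hsq : 1 / 2 ≤ Real.sin θ ^ 2 := by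
        have : Real.sin (Real.pi / 4) ^ 2 ≤ Real.sin θ ^ 2 :=
          pow_le_pow_left₀ sin_pi_div_four_pos.le hsin 2
        rw [Real.sin_pi_div_four, div_pow, Real.sq_sqrt (by norm_num)] at this
        linarith
      have hx : 0 < 1 / (2 * s ^ 2) := by positivity
      have hle : 1 / (2 * s ^ 2) ≤ (s⁻¹ * Real.sin θ) ^ 2 := by
        calc 1 / (2 * s ^ 2) = s⁻¹ ^ 2 * (1 / 2) := by field_simp
          _ ≤ s⁻¹ ^ 2 * Real.sin θ ^ 2 := by gcongr
          _ = _ := by ring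
      rw [Real.norm_eq_abs, abs_of_pos (Real.exp_pos _), Real.exp_neg]
      have h3 := Real.pow_div_factorial_le_exp (1 / (2 * s ^ 2)) hx.le (K + 1)
      have h4 := h3.trans (Real.exp_le_exp.2 hle)
      refine (inv_anti₀ (by positivity) h4).trans_eq ?_
      rw [div_pow, one_pow, mul_pow, ← pow_mul]
      field_simp
    have h5 := intervalIntegral.norm_integral_le_of_norm_le_const hb
    rw [norm_mul, norm_inv, Real.norm_eq_abs s, Real.norm_eq_abs (s ^ K), abs_of_pos hs0,
      abs_of_pos (pow_pos hs0 K)]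
    have h6 : |Real.pi / 2 - Real.pi / 4| = Real.pi / 4 := by
      rw [abs_of_nonneg (by linarith [Real.pi_pos])]
      ring
    rw [h6] at h5
    calc s⁻¹ * _ ≤ s⁻¹ * ((K + 1).factorial * 2 ^ (K + 1) * s ^ (2 * (K + 1)) * (Real.pi / 4)) :=
          mul_le_mul_of_nonneg_left h5 (by positivity)
      _ = (K + 1).factorial * 2 ^ (K + 1) * (Real.pi / 4) * (s ^ K * s ^ (K + 1)) := by
          rw [← pow_add, show 2 * (K + 1) = (K + (K + 1)) + 1 by ring, pow_succ]
          field_simp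
          ring
      _ ≤ (K + 1).factorial * 2 ^ (K + 1) * (Real.pi / 4) * (s ^ K * 1) := by
          gcongr
          exact pow_le_one₀ hs0.le hs.2.le
      _ = _ := by rw [mul_one]
  have h3 := (HasPowerExpansion.eval (K := K) (Polynomial.C (2 / Real.pi))).mul (h1.add h2)
  refine h3.congr' fun s hs => ?_
  rw [circleHeat_sq_div_two, integral_exp_neg_mul_sin_sq]
  have h4 := MeasureTheory.integral_comp_mul_left_Ioi
    (fun w => Real.exp (-(s⁻¹ * w) ^ 2) * arcsinJacobian w) 0 hs
  simp only [inv_mul_cancel_left₀ hs.ne', mul_zero, smul_eq_mul] at h4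
  rw [h4, Polynomial.eval_C]
  ring

theorem hasLogExpansion_resolventDensity_inv_one (j K : ℕ) :
    HasLogExpansion K fun s => resolventDensity j s⁻¹ 1 := by
  have hc := continuous_circleHeat
  have h1 : HasPowerExpansion K fun s => ∫ r in Set.Ioi (0 : ℝ),
      (r ^ (2 * j + 1) * Real.exp (-r ^ 2)) *
        (fun u => circleHeat ((u / Real.pi) ^ 2 / 2) ^ (j + 1)) (s * r) := by
    refine HasPowerExpansion.integral_scaling (V := fun r => r) (C := 1)
      ((hasPowerExpansion_circleHeat K).pow (j + 1)) (fun u _ => ?_)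
      (Continuous.measurable (by fun_prop)) (fun k _ => ?_)
      (MeasureTheory.ae_restrict_mem measurableSet_Ioi) measurable_id
    · rw [abs_of_nonneg (pow_nonneg (circleHeat_nonneg _) _)]
      exact pow_le_one₀ (circleHeat_nonneg _) (circleHeat_le_one (by positivity))
    · refine (integrableOn_pow_mul_exp_neg_sq (2 * j + 1 + k)).congr_fun (fun u _ => ?_)
        measurableSet_Ioi
      simp only [pow_add]
      ring
  have h2 := (HasPowerExpansion.eval (K := K)
    (Polynomial.C (2 / j.factorial : ℝ) * Polynomial.X ^ (2 * j + 2))).mul h1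
  refine HasLogExpansion.of_hasPowerExpansion (h2.congr' fun s hs => ?_)
  have h3 := MeasureTheory.integral_comp_mul_left_Ioi (fun u => resolventWeight j s⁻¹ u *
    (1 * circleHeat ((u * 1 / Real.pi) ^ 2 / 2)) ^ (j + 1)) 0 hs
  rw [mul_zero, smul_eq_mul] at h3
  have h4 : ∀ r : ℝ, resolventWeight j s⁻¹ (s * r) *
      (1 * circleHeat ((s * r * 1 / Real.pi) ^ 2 / 2)) ^ (j + 1) =
      s ^ (2 * j + 1) * ((r ^ (2 * j + 1) * Real.exp (-r ^ 2)) *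
        circleHeat ((s * r / Real.pi) ^ 2 / 2) ^ (j + 1)) := by
    intro r
    rw [resolventWeight, ← mul_pow, mul_right_comm s r, mul_inv_cancel₀ hs.ne', one_mul, one_mul,
      mul_one, mul_pow]
    ring
  simp_rw [h4] at h3
  rw [MeasureTheory.integral_const_mul, eq_inv_mul_iff_mul_eq₀ hs.ne'] at h3
  rw [resolventDensity, ← h3]
  simp only [Polynomial.eval_mul, Polynomial.eval_C, Polynomial.eval_pow, Polynomial.eval_X]
  ring

/-! ### Massless limit -/

theorem integrableOn_Ioi_pow_mul_inv_pow_mul_exp (j i : ℕ) {a b : ℝ} (ha : 0 < a) (hb : 0 < b) :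
    MeasureTheory.IntegrableOn (fun u : ℝ => u ^ j * u⁻¹ ^ i * Real.exp (-(u ^ 2 * b)))
      (Set.Ioi a) := by
  have h := (integrableOn_pow_mul_exp_neg_mul_sq j hb).mono_set (Set.Ioi_subset_Ioi ha.le)
  refine (h.const_mul (a⁻¹ ^ i)).mono' (Measurable.aestronglyMeasurable (by fun_prop)) ?_
  filter_upwards [MeasureTheory.ae_restrict_mem measurableSet_Ioi] with u hu
  have hu0 : 0 < u := ha.trans hu
  have hua : u⁻¹ ≤ a⁻¹ := inv_anti₀ ha (le_of_lt hu)
  rw [Real.norm_eq_abs, abs_of_nonneg (by positivity)]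
  calc u ^ j * u⁻¹ ^ i * Real.exp (-(u ^ 2 * b)) = u⁻¹ ^ i * (u ^ j * Real.exp (-(u ^ 2 * b))) := by
        ring
    _ ≤ _ := by gcongr

theorem HasLogExpansion.pow_mul_integral_zpow (K j i l : ℕ) :
    HasLogExpansion K fun s => s ^ i * ∫ u in s..1, u ^ ((j : ℤ) + l - i) := by
  by_cases hq : (j : ℤ) + l - i = -1
  · refine ((HasLogExpansion.eval_mul_log (K := K) (Polynomial.X ^ i)).const_mul (-1)).congr' ?_
    filter_upwards [self_mem_nhdsWithin] with s hs
    rw [hq]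
    simp only [zpow_neg_one]
    rw [integral_inv_of_pos hs one_pos, one_div, Real.log_inv]
    simp
  · refine (HasLogExpansion.of_hasPowerExpansion (HasPowerExpansion.eval (K := K)
      (Polynomial.C ((((j : ℤ) + l - i : ℤ) : ℝ) + 1)⁻¹ *
        (Polynomial.X ^ i - Polynomial.X ^ (j + l + 1))))).congr' ?_
    filter_upwards [Ioo_mem_nhdsGT (zero_lt_one : (0 : ℝ) < 1)] with s hs
    rw [integral_zpow (Or.inr ⟨hq, fun h => by
      rw [Set.uIcc_of_le hs.2.le] at h
      exact absurd h.1 (not_le.2 hs.1)⟩), one_zpow]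
    have h1 : s ^ i * s ^ ((j : ℤ) + l - i + 1) = s ^ (j + l + 1) := by
      rw [← zpow_natCast, ← zpow_natCast, ← zpow_add₀ hs.1.ne']
      congr 1
      push_cast
      ring
    simp only [Polynomial.eval_mul, Polynomial.eval_C, Polynomial.eval_sub, Polynomial.eval_pow,
      Polynomial.eval_X]
    rw [← h1]
    ring

/-- Expansion of the truncated incomplete Gamma-type integral, including its logarithm. -/
theorem hasLogExpansion_integral_Ioi (K j i : ℕ) :
    HasLogExpansion K fun s => s ^ i * ∫ u in Set.Ioi s, u ^ j * u⁻¹ ^ i * Real.exp (-u ^ 2) := by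
  obtain ⟨p, hp, c, hc0, hc⟩ := (hasPowerExpansion_exp_neg_sq (K + i)).exists_global
    (fun u _ => abs_exp_neg_sq_le_one u)
  set ρ : ℝ → ℝ := fun u => u ^ j * u⁻¹ ^ i * (Real.exp (-u ^ 2) - p.eval u) with hρ
  have hpm : Measurable fun u => p.eval u := p.continuous.measurable
  have hρm : Measurable ρ := by fun_prop
  have hρb : ∀ u, 0 < u → u ≤ 1 → ‖ρ u‖ ≤ c * u ^ K := by
    intro u hu hu1
    rw [hρ, norm_mul, Real.norm_eq_abs, Real.norm_eq_abs, abs_of_pos (by positivity)]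
    calc u ^ j * u⁻¹ ^ i * |Real.exp (-u ^ 2) - p.eval u| ≤
          1 * u⁻¹ ^ i * (c * u ^ (K + i)) := by
          gcongr
          · exact pow_le_one₀ hu.le hu1
          · exact hc u hu
      _ = c * u ^ K := by
          rw [pow_add, inv_pow]
          field_simp
  have hρi : ∀ a b : ℝ, 0 ≤ a → a ≤ b → b ≤ 1 →
      IntervalIntegrable ρ MeasureTheory.volume a b := by
    intro a b ha hab hb
    rw [intervalIntegrable_iff_integrableOn_Ioc_of_le hab]
    refine MeasureTheory.IntegrableOn.of_bound measure_Ioc_lt_top hρm.aestronglyMeasurable c ?_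
    filter_upwards [MeasureTheory.ae_restrict_mem measurableSet_Ioc] with u hu
    have hu0 : 0 < u := lt_of_le_of_lt ha hu.1
    have hu1 : u ≤ 1 := hu.2.trans hb
    exact (hρb u hu0 hu1).trans (mul_le_of_le_one_right hc0 (pow_le_one₀ hu0.le hu1))
  have hrem : HasLogExpansion K fun s => s ^ i * ∫ u in (0 : ℝ)..s, ρ u := by
    refine HasLogExpansion.of_hasPowerExpansion (HasPowerExpansion.of_isBigO
      (IsBigO.of_bound c ?_))
    filter_upwards [Ioo_mem_nhdsGT (zero_lt_one : (0 : ℝ) < 1)] with s hs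
    have h := intervalIntegral.norm_integral_le_of_norm_le_const (a := 0) (b := s) (f := ρ)
      (C := c * s ^ K) fun u hu => by
        rw [Set.uIoc_of_le hs.1.le] at hu
        refine (hρb u hu.1 (hu.2.trans hs.2.le)).trans ?_
        have := pow_le_pow_left₀ hu.1.le hu.2 K
        gcongr
    rw [sub_zero, abs_of_pos hs.1] at h
    have hsK := pow_pos hs.1 K
    rw [norm_mul, norm_pow, norm_pow, Real.norm_eq_abs s, abs_of_pos hs.1]
    calc s ^ i * ‖∫ u in (0 : ℝ)..s, ρ u‖ ≤ 1 * (c * s ^ K * s) :=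
          mul_le_mul (pow_le_one₀ hs.1.le hs.2.le) h (norm_nonneg _) zero_le_one
      _ ≤ c * s ^ K := by
          rw [one_mul]
          exact mul_le_of_le_one_right (by positivity) hs.2.le
  have hconst := HasLogExpansion.of_hasPowerExpansion (HasPowerExpansion.eval (K := K)
    (Polynomial.C ((∫ u in Set.Ioi (1 : ℝ), u ^ j * u⁻¹ ^ i * Real.exp (-u ^ 2)) +
      ∫ u in (0 : ℝ)..1, ρ u) * Polynomial.X ^ i))
  have hpoly := HasLogExpansion.sum (Finset.range (K + i + 1)) fun l _ =>
    (HasLogExpansion.pow_mul_integral_zpow K j i l).const_mul (p.coeff l)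
  refine ((hconst.add (hrem.const_mul (-1))).add hpoly).congr' ?_
  filter_upwards [Ioo_mem_nhdsGT (zero_lt_one : (0 : ℝ) < 1)] with s hs
  have hint : ∀ a : ℝ, 0 < a → MeasureTheory.IntegrableOn
      (fun u : ℝ => u ^ j * u⁻¹ ^ i * Real.exp (-u ^ 2)) (Set.Ioi a) := fun a ha => by
    simpa using integrableOn_Ioi_pow_mul_inv_pow_mul_exp j i ha one_pos
  have h1 : ∫ u in Set.Ioi s, u ^ j * u⁻¹ ^ i * Real.exp (-u ^ 2) =
      (∫ u in s..1, u ^ j * u⁻¹ ^ i * Real.exp (-u ^ 2)) +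
        ∫ u in Set.Ioi (1 : ℝ), u ^ j * u⁻¹ ^ i * Real.exp (-u ^ 2) := by
    rw [intervalIntegral.integral_of_le hs.2.le, ← MeasureTheory.setIntegral_union
      (Set.Ioc_disjoint_Ioi le_rfl) measurableSet_Ioi
      ((hint s hs.1).mono_set Set.Ioc_subset_Ioi_self) (hint 1 one_pos),
      Set.Ioc_union_Ioi_eq_Ioi hs.2.le]
  have hne : ∀ u ∈ Set.uIcc s 1, u ≠ 0 := by
    intro u hu
    rw [Set.uIcc_of_le hs.2.le] at hu
    exact (hs.1.trans_le hu.1).ne'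
  have hzi : ∀ l : ℕ, IntervalIntegrable (fun u : ℝ => u ^ ((j : ℤ) + l - i))
      MeasureTheory.volume s 1 := fun l =>
    ContinuousOn.intervalIntegrable fun u hu =>
      (continuousAt_zpow₀ u _ (Or.inl (hne u hu))).continuousWithinAt
  have h2 : ∫ u in s..1, u ^ j * u⁻¹ ^ i * Real.exp (-u ^ 2) = (∫ u in s..1, ρ u) +
      ∑ l ∈ Finset.range (K + i + 1), p.coeff l * ∫ u in s..1, u ^ ((j : ℤ) + l - i) := by
    have hsi : IntervalIntegrable (fun u : ℝ => ∑ l ∈ Finset.range (K + i + 1),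
        p.coeff l * u ^ ((j : ℤ) + l - i)) MeasureTheory.volume s 1 := by
      have h := IntervalIntegrable.sum (Finset.range (K + i + 1)) fun l _ =>
        (hzi l).const_mul (p.coeff l)
      rwa [Finset.sum_fn] at h
    simp_rw [← intervalIntegral.integral_const_mul]
    rw [← intervalIntegral.integral_finsetSum fun l _ => (hzi l).const_mul _,
      ← intervalIntegral.integral_add (hρi s 1 hs.1.le hs.2.le le_rfl) hsi]
    refine intervalIntegral.integral_congr fun u hu => ?_
    have hu0 := hne u hu
    simp only [hρ]
    have h3 : ∑ l ∈ Finset.range (K + i + 1), p.coeff l * u ^ ((j : ℤ) + l - i) =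
        u ^ j * u⁻¹ ^ i * p.eval u := by
      rw [Polynomial.eval_eq_sum_range' (Nat.lt_succ_of_le hp), Finset.mul_sum]
      refine Finset.sum_congr rfl fun l _ => ?_
      rw [zpow_sub₀ hu0, zpow_add₀ hu0, zpow_natCast, zpow_natCast, zpow_natCast, inv_pow]
      ring
    rw [h3]
    ring
  have h4 : ∫ u in s..1, ρ u = (∫ u in (0 : ℝ)..1, ρ u) - ∫ u in (0 : ℝ)..s, ρ u := by
    rw [intervalIntegral.integral_interval_sub_left (hρi 0 1 le_rfl zero_le_one le_rfl)
      (hρi 0 s le_rfl hs.1.le hs.2.le)]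
  rw [h1, h2, h4]
  simp only [Polynomial.eval_mul, Polynomial.eval_C, Polynomial.eval_pow, Polynomial.eval_X]
  have h5 : ∑ l ∈ Finset.range (K + i + 1),
      p.coeff l * (s ^ i * ∫ u in s..1, u ^ ((j : ℤ) + l - i)) =
      s ^ i * ∑ l ∈ Finset.range (K + i + 1),
        p.coeff l * ∫ u in s..1, u ^ ((j : ℤ) + l - i) := by
    rw [Finset.mul_sum]
    exact Finset.sum_congr rfl fun l _ => by ring
  rw [h5]
  ring

theorem hasLogExpansion_pow_mul_integral_Ioi_one (K j i : ℕ) :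
    HasLogExpansion K fun s => s ^ (j + 1) *
      ∫ u in Set.Ioi (1 : ℝ), u ^ j * u⁻¹ ^ i * Real.exp (-(s * u) ^ 2) := by
  refine (hasLogExpansion_integral_Ioi K j i).congr' ?_
  filter_upwards [self_mem_nhdsWithin] with s hs
  have hs0 : 0 < s := hs
  have h := MeasureTheory.integral_comp_mul_left_Ioi
    (fun u => u ^ j * u⁻¹ ^ i * Real.exp (-u ^ 2)) 1 hs0
  rw [mul_one, smul_eq_mul, eq_inv_mul_iff_mul_eq₀ hs0.ne'] at h
  rw [← h, ← MeasureTheory.integral_const_mul, ← MeasureTheory.integral_const_mul,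
    ← MeasureTheory.integral_const_mul]
  refine MeasureTheory.setIntegral_congr_fun measurableSet_Ioi fun u _ => ?_
  simp only [mul_inv, mul_pow, inv_pow]
  field_simp
  ring

theorem hasLogExpansion_resolventDensity_one_inv (j K : ℕ) :
    HasLogExpansion K fun s => resolventDensity j 1 s⁻¹ := by
  have hcc := continuous_circleHeat
  have hpi := Real.pi_pos
  set Φ : ℝ → ℝ := fun u => circleHeat ((u / Real.pi) ^ 2 / 2) with hΦ
  have hΦc : Continuous Φ := by fun_prop
  have hΦ0 : ∀ u, 0 ≤ Φ u := fun u => circleHeat_nonneg _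
  have hΦ1 : ∀ u, Φ u ≤ 1 := fun u => circleHeat_le_one (by positivity)
  set B : ℝ → ℝ := fun s => (s⁻¹ * Φ s⁻¹) ^ (j + 1) with hB
  have hBK : HasPowerExpansion (K + j + 2) B := by
    have h1 := ((hasPowerExpansion_inv_mul_circleHeat (K + j + 2)).comp_mul_left hpi)
    have h2 := ((HasPowerExpansion.eval (Polynomial.C Real.pi)).mul h1).pow (j + 1)
    refine h2.congr' fun s hs => ?_
    simp only [hB, hΦ, Polynomial.eval_C]
    congr 1
    rw [mul_inv, ← mul_assoc, mul_inv_cancel_left₀ hpi.ne', div_eq_inv_mul s⁻¹ Real.pi]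
  have hBb : ∀ s, 0 < s → |B s| ≤ Real.pi ^ (j + 1) := by
    intro s hs
    have hs' : 0 < s⁻¹ := inv_pos.2 hs
    rw [abs_of_nonneg (pow_nonneg (mul_nonneg hs'.le (hΦ0 _)) _)]
    refine pow_le_pow_left₀ (mul_nonneg hs'.le (hΦ0 _)) ?_ _
    have h := mul_circleHeat_le (div_pos hs' hpi)
    rw [div_mul_eq_mul_div, div_le_one hpi] at h
    exact h
  obtain ⟨p, hp, c, hc0, hc⟩ := hBK.exists_global hBb
  set N := K + j + 2
  set W : ℝ → ℝ := fun u => u ^ (2 * j + 1) * Φ u ^ (j + 1) with hW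
  have hWc : Continuous W := by fun_prop
  -- the part near zero
  have hnear : HasPowerExpansion K fun s => ∫ u in Set.Ioc (0 : ℝ) 1, W u *
      (fun u => Real.exp (-u ^ 2)) (s * u) := by
    refine HasPowerExpansion.integral_scaling (V := fun u => u) (hasPowerExpansion_exp_neg_sq K)
      (fun u _ => abs_exp_neg_sq_le_one u) (by fun_prop) (fun k _ => ?_) ?_ measurable_id
    · exact (Continuous.integrableOn_Icc (by fun_prop)).mono_set Set.Ioc_subset_Icc_self
    · filter_upwards [MeasureTheory.ae_restrict_mem measurableSet_Ioc] with u hu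
      exact hu.1
  -- the remainder of the tail
  have hpc : Continuous fun u => p.eval u := p.continuous
  set R : ℝ → ℝ := fun u => u ^ j * (B u⁻¹ - p.eval u⁻¹) with hR
  have hRm : Measurable R := by
    have h1 := hΦc.measurable
    have h2 := hpc.measurable
    simp only [hR, hB]
    fun_prop
  have hRb : ∀ k ≤ K, ∀ u, 1 < u → ‖R u * u ^ k‖ ≤ c * u ^ (-2 : ℝ) := by
    intro k hk u hu
    have hu0 : 0 < u := by linarith
    rw [hR, norm_mul, norm_mul, norm_pow, norm_pow, Real.norm_eq_abs, Real.norm_eq_abs,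
      abs_of_pos hu0, Real.rpow_neg hu0.le, Real.rpow_ofNat]
    calc u ^ j * |B u⁻¹ - p.eval u⁻¹| * u ^ k ≤ u ^ j * (c * u⁻¹ ^ N) * u ^ K := by
          gcongr
          · exact hc _ (inv_pos.2 hu0)
          · exact hu.le
      _ = c * (u ^ 2)⁻¹ := by
          rw [inv_pow, show N = K + (j + 2) from rfl, pow_add, pow_add]
          field_simp
  have htail : HasPowerExpansion K fun s => ∫ u in Set.Ioi (1 : ℝ), R u *
      (fun u => Real.exp (-u ^ 2)) (s * u) := by
    refine HasPowerExpansion.integral_scaling (V := fun u => u) (hasPowerExpansion_exp_neg_sq K)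
      (fun u _ => abs_exp_neg_sq_le_one u) (by fun_prop) (fun k hk => ?_) ?_ measurable_id
    · refine MeasureTheory.Integrable.mono' ((integrableOn_Ioi_rpow_of_lt
        (by norm_num : (-2 : ℝ) < -1) one_pos).const_mul c)
        (Measurable.aestronglyMeasurable (by fun_prop)) ?_
      filter_upwards [MeasureTheory.ae_restrict_mem measurableSet_Ioi] with u hu
      exact hRb k hk u hu
    · filter_upwards [MeasureTheory.ae_restrict_mem measurableSet_Ioi] with u hu
      exact zero_lt_one.trans hu
  have hpow : HasPowerExpansion K fun s => s ^ (j + 1) := by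
    simpa using HasPowerExpansion.eval (K := K) (Polynomial.X ^ (j + 1))
  have hlogs := HasLogExpansion.sum (Finset.range (N + 1)) fun i _ =>
    (hasLogExpansion_pow_mul_integral_Ioi_one K j i).const_mul (p.coeff i)
  refine (((HasLogExpansion.of_hasPowerExpansion (hpow.mul (hnear.add htail))).add
    hlogs).const_mul (2 / j.factorial)).congr' ?_
  filter_upwards [self_mem_nhdsWithin] with s hs
  have hs0 : 0 < s := hs
  have hs2 : 0 < s ^ 2 := by positivity
  have hexp : ∀ u : ℝ, Real.exp (-(s * u) ^ 2) = Real.exp (-(u ^ 2 * s ^ 2)) := fun u => by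
    ring_nf
  have hWi : MeasureTheory.IntegrableOn (fun u => W u * Real.exp (-(s * u) ^ 2)) (Set.Ioi 0) := by
    simp_rw [hexp]
    refine (integrableOn_pow_mul_exp_neg_mul_sq (2 * j + 1) hs2).mono'
      (Continuous.aestronglyMeasurable (by fun_prop)) ?_
    filter_upwards [MeasureTheory.ae_restrict_mem measurableSet_Ioi] with u hu
    have hu0 : 0 < u := hu
    have h1 := hΦ0 u
    rw [Real.norm_eq_abs, abs_of_nonneg (by positivity)]
    refine mul_le_mul_of_nonneg_right ?_ (Real.exp_pos _).le
    exact mul_le_of_le_one_right (by positivity) (pow_le_one₀ h1 (hΦ1 u))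
  have hpi' : ∀ i, MeasureTheory.IntegrableOn (fun u : ℝ => p.coeff i *
      (u ^ j * u⁻¹ ^ i * Real.exp (-(s * u) ^ 2))) (Set.Ioi 1) := fun i => by
    simp_rw [hexp]
    exact (integrableOn_Ioi_pow_mul_inv_pow_mul_exp j i one_pos hs2).const_mul _
  have hsplit : ∀ u, 1 < u → W u * Real.exp (-(s * u) ^ 2) = R u * Real.exp (-(s * u) ^ 2) +
      ∑ i ∈ Finset.range (N + 1), p.coeff i * (u ^ j * u⁻¹ ^ i * Real.exp (-(s * u) ^ 2)) := by
    intro u hu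
    have hu0 : 0 < u := by linarith
    have h1 : ∑ i ∈ Finset.range (N + 1), p.coeff i *
        (u ^ j * u⁻¹ ^ i * Real.exp (-(s * u) ^ 2)) =
        u ^ j * p.eval u⁻¹ * Real.exp (-(s * u) ^ 2) := by
      rw [Polynomial.eval_eq_sum_range' (Nat.lt_succ_of_le hp), Finset.mul_sum, Finset.sum_mul]
      exact Finset.sum_congr rfl fun i _ => by ring
    rw [h1]
    simp only [hW, hR, hB, inv_inv]
    ring
  have hsum := MeasureTheory.integrable_finsetSum (Finset.range (N + 1)) fun i _ => hpi' i
  have hRi : MeasureTheory.IntegrableOn (fun u => R u * Real.exp (-(s * u) ^ 2)) (Set.Ioi 1) := by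
    refine ((hWi.mono_set (Set.Ioi_subset_Ioi zero_le_one)).sub hsum).congr ?_
    filter_upwards [MeasureTheory.ae_restrict_mem measurableSet_Ioi] with u hu
    simp only [Pi.sub_apply]
    rw [hsplit u hu, add_sub_cancel_right]
  have hmain : ∫ u in Set.Ioi (0 : ℝ), W u * Real.exp (-(s * u) ^ 2) =
      (∫ u in Set.Ioc (0 : ℝ) 1, W u * Real.exp (-(s * u) ^ 2)) +
        ((∫ u in Set.Ioi (1 : ℝ), R u * Real.exp (-(s * u) ^ 2)) +
          ∑ i ∈ Finset.range (N + 1), p.coeff i *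
            ∫ u in Set.Ioi (1 : ℝ), u ^ j * u⁻¹ ^ i * Real.exp (-(s * u) ^ 2)) := by
    rw [← Set.Ioc_union_Ioi_eq_Ioi (zero_le_one : (0 : ℝ) ≤ 1), MeasureTheory.setIntegral_union
      (Set.Ioc_disjoint_Ioi le_rfl) measurableSet_Ioi
      (hWi.mono_set Set.Ioc_subset_Ioi_self) (hWi.mono_set (Set.Ioi_subset_Ioi zero_le_one)),
      MeasureTheory.setIntegral_congr_fun measurableSet_Ioi fun u hu => hsplit u hu,
      MeasureTheory.integral_add hRi hsum,
      MeasureTheory.integral_finsetSum _ fun i _ => hpi' i]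
    simp_rw [MeasureTheory.integral_const_mul]
  have h3 := MeasureTheory.integral_comp_mul_left_Ioi (fun u => resolventWeight j 1 u *
    (s⁻¹ * circleHeat ((u * s⁻¹ / Real.pi) ^ 2 / 2)) ^ (j + 1)) 0 hs0
  rw [mul_zero, smul_eq_mul] at h3
  have h4 : ∀ u : ℝ, resolventWeight j 1 (s * u) *
      (s⁻¹ * circleHeat ((s * u * s⁻¹ / Real.pi) ^ 2 / 2)) ^ (j + 1) =
      s ^ j * (W u * Real.exp (-(s * u) ^ 2)) := by
    intro u
    rw [resolventWeight, mul_right_comm s u, mul_inv_cancel₀ hs0.ne', one_mul, one_pow, mul_one,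
      mul_pow s⁻¹, inv_pow]
    simp only [hW, hΦ]
    rw [mul_pow s u (2 * j + 1), show 2 * j + 1 = j + (j + 1) by ring, pow_add s j (j + 1)]
    field_simp
  simp_rw [h4] at h3
  rw [MeasureTheory.integral_const_mul, eq_inv_mul_iff_mul_eq₀ hs0.ne', hmain] at h3
  rw [resolventDensity, ← h3]
  have h5 : ∑ i ∈ Finset.range (N + 1), p.coeff i * (s ^ (j + 1) *
      ∫ u in Set.Ioi (1 : ℝ), u ^ j * u⁻¹ ^ i * Real.exp (-(s * u) ^ 2)) =
      s ^ (j + 1) * ∑ i ∈ Finset.range (N + 1), p.coeff i *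
        ∫ u in Set.Ioi (1 : ℝ), u ^ j * u⁻¹ ^ i * Real.exp (-(s * u) ^ 2) := by
    rw [Finset.mul_sum]
    exact Finset.sum_congr rfl fun i _ => by ring
  rw [h5]
  ring

theorem theorem1p3 (m : ℕ) (hm : 1 ≤ m) :
    ∃ (h : Fin (m + 1) → ℝ → ℝ → ℝ) (H : ℝ → ℕ → ℝ),
      (∀ (n : ℕ) (z : ℝ), 0 < n → 0 < z →
        resolventTrace m n z = (∑ j : Fin (m + 1), h j z (n : ℝ)) + H z n) ∧
      (∀ j : Fin (m + 1),
        ContDiffOn ℝ ∞ (fun p : ℝ × ℝ => h j p.1 p.2) (Set.Ioi 0 ×ˢ Set.Ioi 0) ∧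
        (∀ t z n : ℝ, 0 < t → 0 < z → 0 < n →
          h j (t * z) (t * n) = t ^ (-(m : ℤ) - ((j : ℕ) : ℤ)) * h j z n) ∧
        HasLogPolyhomogeneousExpansion (fun z : ℝ => (h j z 1 : ℂ)) ∧
        HasLogPolyhomogeneousExpansion (fun n : ℝ => (h j 1 n : ℂ))) ∧
      (∃ C z₀ : ℝ, 0 < z₀ ∧ ∀ (n : ℕ) (z : ℝ), 0 < n → z₀ ≤ z →
        |H z n| ≤ C * z ^ (-2 * (m : ℤ) - 2)) ∧
      (∀ z n : ℝ, 0 < z → 0 < n → h (Fin.last m) z n = 0) := by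
  obtain ⟨d, rfl⟩ : ∃ d, m = d + 1 := ⟨m - 1, by omega⟩
  obtain ⟨C, hC⟩ := exists_abs_resolventTrace_sub_le d
  refine ⟨Fin.cons (resolventDensity d) fun _ _ _ => 0,
    fun z n => resolventTrace (d + 1) n z - resolventDensity d z n, ?_, ?_, ?_, ?_⟩
  · intro n z _ _
    rw [Fin.sum_univ_succ]
    simp
  · refine Fin.cases ⟨contDiffOn_resolventDensity d, ?_, ?_, ?_⟩ fun i => ⟨?_, ?_, ?_, ?_⟩
    · intro t z n ht _ _
      simp only [Fin.cons_zero, Fin.val_zero]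
      rw [resolventDensity_homogeneous d ht]
      push_cast
      ring_nf
    · exact hasLogPolyhomogeneousExpansion_of_hasLogExpansion
        (hasLogExpansion_resolventDensity_inv_one d)
    · exact hasLogPolyhomogeneousExpansion_of_hasLogExpansion
        (hasLogExpansion_resolventDensity_one_inv d)
    · simpa using contDiffOn_const
    · intro t z n _ _ _
      simp
    all_goals
      refine hasLogPolyhomogeneousExpansion_of_hasLogExpansion (f := fun _ => 0) fun K => ?_
      simpa using HasLogExpansion.of_hasPowerExpansion (HasPowerExpansion.eval (K := K) 0)
  · exact ⟨C, 1, one_pos, fun n z hn hz => hC n z hn hz⟩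
  · intro z n _ _
    rw [← Fin.succ_last, Fin.cons_succ]
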